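/- Let $p\ge 2$, let $dx$ be the surface measure of $\mathbb S^{p-1}\subset\mathbb R^p$, of total mass $\omega=2\pi^{p/2}/\Gamma(p/2)$, and fix $\mu\in\mathbb S^{p-1}$. For $\ell\ge 0$ let $P_\ell$ be the Legendre polynomial in dimension $p$, that is, the Gegenbauer polynomial $C_\ell^{(p-2)/2}$ normalized by $P_\ell(1)=1$ (the Chebyshev polynomial $T_\ell$ if $p=2$), and put $$c_{p,\ell}=\frac1\omega\,\frac{(2\ell+p-2)\,\Gamma(\ell+p-2)}{\ell!\,\Gamma(p-1)}$$ (read as $1/\omega$ for $\ell=0$). For an integrable function $\varphi$ on the sphere put $\widehat\varphi_\ell=\int\varphi(x)P_\ell(\mu^Tx)\,dx$ and $S_L\varphi(x)=\sum_{\ell<L}c_{p,\ell}\widehat\varphi_\ell P_\ell(\mu^Tx)$. Let $g$ be a measurable function, nonnegative on $[-1,1]$, such that $y\mapsto g(x^Ty)$ is a probability density on $\mathbb S^{p-1}$ for every $x$. Let $(x_k)_{k\ge 0}$ be the isotropic random walk with $x_0=\mu$ in which $x_{k+1}$ has conditional density $y\mapsto g(x_k^Ty)$ given $x_0,\dots,x_k$.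 Let $N$ be a Cox process with cumulative random intensity $\Lambda$ (given $\Lambda$, the increments of $N$ over successive intervals are independent Poisson variables with parameters the increments of $\Lambda$), with $N$ independent of the walk. Put $x_t=x_{N(t)}$, $N_t=N(t)$, $\Lambda_t=\Lambda(t)$, $\mathcal L_{\Lambda_t}[z]=E[e^{-z\Lambda_t}]$, $G_{N_t}[z]=E[z^{N_t}]$, $\mathcal P_n=E[e^{-\Lambda_t}\Lambda_t^n/n!]$. Let $f(x)=f^{\otimes1}(x)=g(\mu^Tx)$, $f^{\otimes (n+1)}(x)=\int g(x^Ty)f^{\otimes n}(y)\,dy$, and $h=\sum_{n\ge1}\mathcal P_n f^{\otimes n}$. Fix $t\ge 0$. Then: 1. $\Pr(N_t=n)=\mathcal P_n$ for all $n\ge0$; in particular $\Pr(N_t=0)=\mathcal P_0=\mathcal L_{\Lambda_t}[1]=G_{N_t}[0]$. 2. $h$ is integrable, and the law of $x_t$ is $\Pr(N_t=0)\,\delta_\mu+h(x)\,dx$. If $g$ is continuous on $[-1,1]$, then $h$ is continuous. 3. For all $\ell\ge0$, $\widehat h_\ell=\mathcal L_{\Lambda_t}[1-\widehat f_\ell]-\mathcal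 L_{\Lambda_t}[1]=G_{N_t}[\widehat f_\ell]-G_{N_t}[0]$. 4. Suppose that $f$ is square integrable (for instance, that $g$ is continuous on $[-1,1]$). Then $h$ is square integrable and has the Fourier expansion $h(x)=\sum_{\ell\ge0}c_{p,\ell}\,\widehat h_\ell\,P_\ell(\mu^Tx)$ in $L^2(\mathbb S^{p-1})$. Moreover, for every $x\in\mathbb S^{p-1}$, $S_Lh(x)-\mathcal P_1S_Lf(x)\to h(x)-\mathcal P_1f(x)$ as $L\to\infty$, so that the expansion of $h$ also holds pointwise at every $x$ at which the step density is the sum of its own expansion, i.e. $S_Lf(x)\to f(x)$. In particular, if $g$ is continuous on $[-1,1]$ and $\sum_\ell c_{p,\ell}|\widehat f_\ell|<\infty$, the expansion of $h$ holds, with unconditional convergence, at every $x\in\mathbb S^{p-1}$. 5. For all $\ell\ge0$, $E[P_\ell(\mu^Tx_t)]=G_{N_t}[\widehat f_\ell]=\mathcal L_{\Lambda_t}[1-\widehat f_\ell]$. 6. (Poisson case.) If $\Lambda_t=\lambda_t\ge0$ almost surely, with $\lambda_t$ deterministic, then $N_t$ is Poisson with parameter $\lambda_t$ and, for all $\ell\ge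 0$, $\widehat h_\ell=e^{-\lambda_t}\bigl(e^{\lambda_t\widehat f_\ell}-1\bigr)$ and $E[P_\ell(\mu^Tx_t)]=e^{-\lambda_t(1-\widehat f_\ell)}$. 7. (Negative binomial case.) If $t>0$ and $\Lambda_t$ has the Gamma density $\frac{\theta^{r}}{\Gamma(r)}u^{r-1}e^{-\theta u}$ on $u>0$, with $r=\xi t$ and $\xi,\theta>0$, then with $q=(\theta+1)^{-1}$ one has $\Pr(N_t=n)=\frac{\Gamma(n+r)}{n!\,\Gamma(r)}(1-q)^{r}q^n$ for all $n\ge0$ and, for all $\ell\ge0$, $\widehat h_\ell=(1-q)^{r}\bigl[(1-q\widehat f_\ell)^{-r}-1\bigr]$ and $E[P_\ell(\mu^Tx_t)]=\Bigl(\frac{1-q}{1-q\widehat f_\ell}\Bigr)^{r}$. -/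

import Mathlib

open MeasureTheory ProbabilityTheory Filter Topology
open scoped NNReal ENNReal

namespace CoxSphere

noncomputable section

/-! ### The sphere, Legendre polynomials in dimension `p`, normalizing constants -/

/-- The unit sphere `S^{p-1}` of `ℝ^p`. -/
abbrev Sph (p : ℕ) : Type := Metric.sphere (0 : EuclideanSpace ℝ (Fin p)) 1

/-- The (unnormalized) surface measure `dx` of `S^{p-1}`. -/
def surf (p : ℕ) : Measure (Sph p) :=
  (volume : Measure (EuclideanSpace ℝ (Fin p))).toSphere

/-- `xᵀ y`, the cosine of the angle between two unit vectors. -/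
def dotp {p : ℕ} (x y : Sph p) : ℝ :=
  inner ℝ (x : EuclideanSpace ℝ (Fin p)) (y : EuclideanSpace ℝ (Fin p))

/-- The Gegenbauer (ultraspherical) polynomials `C_ℓ^{(a)}(s)`, by their three term recurrence. -/
def gegenbauer (a : ℝ) : ℕ → ℝ → ℝ
  | 0, _ => 1
  | 1, s => 2 * a * s
  | n + 2, s =>
      (2 * ((n : ℝ) + 1 + a) * s * gegenbauer a (n + 1) s
        - ((n : ℝ) + 2 * a) * gegenbauer a n s) / ((n : ℝ) + 2)

/-- The Legendre polynomial `P_ℓ` in dimension `p`: the Gegenbauer polynomial of index `(p-2)/2`,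
divided by its value `Γ(ℓ+p-2) / (ℓ! Γ(p-2))` at `1`. For `p = 2`, where this quotient degenerates,
it is as usual the limit, the Chebyshev polynomial `T_ℓ(cos u) = cos (ℓ u)`. -/
def legendreP (p ℓ : ℕ) (s : ℝ) : ℝ :=
  if p = 2 then (Polynomial.Chebyshev.T ℝ (ℓ : ℤ)).eval s
  else (Real.Gamma ((ℓ : ℝ) + p - 2) / ((ℓ.factorial : ℝ) * Real.Gamma ((p : ℝ) - 2)))⁻¹
    * gegenbauer (((p : ℝ) - 2) / 2) ℓ s

/-- The area `2 π^{p/2} / Γ(p/2)` of `S^{p-1}`. -/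
def sphArea (p : ℕ) : ℝ := 2 * Real.pi ^ ((p : ℝ) / 2) / Real.Gamma ((p : ℝ) / 2)

/-- The constant `c_{p,ℓ} = (2ℓ+p-2) Γ(ℓ+p-2) / (ℓ! Γ(p-1)) / area`. At `ℓ = 0` the quotient is
`(p-2) Γ(p-2) / Γ(p-1) = 1`; it is written separately because `p = 2`, `ℓ = 0` has to be read as
the limit. -/
def normConst (p ℓ : ℕ) : ℝ :=
  1 / sphArea p *
    (if ℓ = 0 then 1 else
      (2 * (ℓ : ℝ) + p - 2) * Real.Gamma ((ℓ : ℝ) + p - 2)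
        / ((ℓ.factorial : ℝ) * Real.Gamma ((p : ℝ) - 1)))

/-- For `p ≥ 3` the uniform formula holds for every `ℓ`. -/
theorem normConst_eq (p ℓ : ℕ) (hp : 3 ≤ p) :
    normConst p ℓ = 1 / sphArea p *
      ((2 * (ℓ : ℝ) + p - 2) * Real.Gamma ((ℓ : ℝ) + p - 2)
        / ((ℓ.factorial : ℝ) * Real.Gamma ((p : ℝ) - 1))) := by
  unfold normConst
  split_ifs with h
  · subst h
    have h3 : (3 : ℝ) ≤ p := by exact_mod_cast hp
    have h2 : (p : ℝ) - 2 ≠ 0 := by intro h; linarith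
    have hG : Real.Gamma ((p : ℝ) - 1) = ((p : ℝ) - 2) * Real.Gamma ((p : ℝ) - 2) := by
      rw [← Real.Gamma_add_one h2]; congr 1; ring
    have hpos : 0 < Real.Gamma ((p : ℝ) - 2) := Real.Gamma_pos_of_pos (by linarith)
    simp only [Nat.factorial_zero, Nat.cast_zero, Nat.cast_one, mul_zero, zero_add, one_mul, hG]
    rw [div_self (mul_ne_zero h2 hpos.ne')]
  · rfl

/-- The `ℓ`-th Fourier coefficient (Legendre moment) `∫ f(x) P_ℓ(μᵀx) dx` of a function `f` on the
sphere, with respect to the axis `μ`. -/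
def fourierCoeff {p : ℕ} (μ : Sph p) (f : Sph p → ℝ) (ℓ : ℕ) : ℝ :=
  ∫ x, f x * legendreP p ℓ (dotp μ x) ∂(surf p)

/-- Partial sum `∑_{ℓ < L} c_{p,ℓ} f̂_ℓ P_ℓ(μᵀx)` of the Fourier expansion of `f`. -/
def fourierSum {p : ℕ} (μ : Sph p) (f : Sph p → ℝ) (L : ℕ) (x : Sph p) : ℝ :=
  ∑ ℓ ∈ Finset.range L, normConst p ℓ * fourierCoeff μ f ℓ * legendreP p ℓ (dotp μ x)

/-! ### Isotropic random walk -/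

/-- `g` is the profile of an isotropic step: for every `x`, the function `y ↦ g(xᵀy)` is a
probability density on the sphere. -/
structure IsStepProfile (p : ℕ) (g : ℝ → ℝ) : Prop where
  measurable : Measurable g
  nonneg : ∀ s ∈ Set.Icc (-1 : ℝ) 1, 0 ≤ g s
  lintegral_eq_one : ∀ x : Sph p, ∫⁻ y, ENNReal.ofReal (g (dotp x y)) ∂(surf p) = 1

/-- The density `f(x ; μ) = g(μᵀx)` of one step from `μ`. -/
def stepPdf {p : ℕ} (g : ℝ → ℝ) (μ x : Sph p) : ℝ := g (dotp μ x)

/-- The iterated convolutions: `convPdf g μ n` is the `(n+1)`-fold convolution `f^{⊗(n+1)}(· ; μ)`,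
where the convolution of zonal functions is `(f ⋆ h)(x) = ∫ f(xᵀy) h(yᵀμ) dy`. -/
def convPdf {p : ℕ} (g : ℝ → ℝ) (μ : Sph p) : ℕ → Sph p → ℝ
  | 0, x => stepPdf g μ x
  | n + 1, x => ∫ y, g (dotp x y) * convPdf g μ n y ∂(surf p)

/-- `x 0, x 1, …` is the isotropic random walk from `μ` with i.i.d. steps of profile `g`: given
`x 0, …, x k`, the direction `x (k+1)` has density `y ↦ g((x k)ᵀ y)`. -/
structure IsIsotropicWalk {p : ℕ} {Ω : Type*} [MeasurableSpace Ω] (P : Measure Ω)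
    (g : ℝ → ℝ) (μ : Sph p) (x : ℕ → Ω → Sph p) : Prop where
  measurable : ∀ k, Measurable (x k)
  start : ∀ ω, x 0 ω = μ
  step : ∀ (k : ℕ) (A : Set Ω) (B : Set (Sph p)),
    MeasurableSet[⨆ j ∈ Set.Iic k, MeasurableSpace.comap (x j) inferInstance] A →
    MeasurableSet B →
    P (A ∩ x (k + 1) ⁻¹' B)
      = ∫⁻ ω in A, (∫⁻ y in B, ENNReal.ofReal (g (dotp (x k ω) y)) ∂(surf p)) ∂P

/-! ### Cox processes -/

/-- `N` is a Cox process with cumulative random intensity `Λ` (`Λ t` is the intensity measure of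
`(0,t]`): given the whole path of `Λ`, the increments of `N` over successive intervals are
independent Poisson variables with parameters the increments of `Λ`. -/
structure IsCoxProcess {Ω : Type*} [MeasurableSpace Ω] (P : Measure Ω)
    (Λ : ℝ≥0 → Ω → ℝ) (N : ℝ≥0 → Ω → ℕ) : Prop where
  measurable_intensity : ∀ t, Measurable (Λ t)
  intensity_zero : ∀ ω, Λ 0 ω = 0
  intensity_mono : ∀ ω, Monotone fun t => Λ t ω
  measurable_count : ∀ t, Measurable (N t)
  count_zero : ∀ ω, N 0 ω = 0
  count_mono : ∀ ω, Monotone fun t => N t ω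
  poisson_increments : ∀ (m : ℕ) (s : ℕ → ℝ≥0) (k : ℕ → ℕ) (A : Set Ω), Monotone s →
    MeasurableSet[⨆ t, MeasurableSpace.comap (Λ t) inferInstance] A →
    P (A ∩ {ω | ∀ i < m, N (s (i + 1)) ω = N (s i) ω + k i})
      = ∫⁻ ω in A, ∏ i ∈ Finset.range m,
          ENNReal.ofReal (Real.exp (-(Λ (s (i + 1)) ω - Λ (s i) ω))
            * (Λ (s (i + 1)) ω - Λ (s i) ω) ^ k i / ((k i).factorial : ℝ)) ∂P

/-- The data of a compound Cox process on the sphere: a Cox process `N` with intensity `Λ`, and an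
isotropic walk `x` independent of `N`. The process itself is `t ↦ x_{N(t)}`. -/
structure IsCompoundCox {p : ℕ} {Ω : Type*} [MeasurableSpace Ω] (P : Measure Ω)
    (g : ℝ → ℝ) (μ : Sph p) (Λ : ℝ≥0 → Ω → ℝ) (N : ℝ≥0 → Ω → ℕ) (x : ℕ → Ω → Sph p) : Prop where
  cox : IsCoxProcess P Λ N
  walk : IsIsotropicWalk P g μ x
  indep : IndepFun (fun ω k => x k ω) (fun ω t => N t ω) P

/-- The direction `x_t = x_{N(t)}` at time `t`. -/
def position {p : ℕ} {Ω : Type*} (N : ℝ≥0 → Ω → ℕ) (x : ℕ → Ω → Sph p) (t : ℝ≥0) (ω : Ω) : Sph p :=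
  x (N t ω) ω

/-- The Poisson transform `∫ e^{-u} u^n / n! dν(u)` of a mixing law `ν` on the half-line. -/
def poissonTransform (ν : Measure ℝ) (n : ℕ) : ℝ :=
  ∫ u, Real.exp (-u) * u ^ n / (n.factorial : ℝ) ∂ν

/-- The Laplace transform `∫ e^{-zu} dν(u)`. -/
def laplace (ν : Measure ℝ) (z : ℝ) : ℝ := ∫ u, Real.exp (-(z * u)) ∂ν

/-- The probability generating function `E[z^N]`. -/
def genFun {Ω : Type*} [MeasurableSpace Ω] (P : Measure Ω) (N : Ω → ℕ) (z : ℝ) : ℝ :=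
  ∫ ω, z ^ N ω ∂P

/-- The unnormalized density `h^{⊗>0} = ∑_{n ≥ 1} 𝒫_n[ν] f^{⊗n}` of the part with at least one
scattering event. -/
def scatPdf {p : ℕ} (ν : Measure ℝ) (g : ℝ → ℝ) (μ : Sph p) (x : Sph p) : ℝ :=
  ∑' n : ℕ, poissonTransform ν (n + 1) * convPdf g μ n x

end

end CoxSphere

/-!
# Cox random walks on the sphere and their Legendre expansions

The mathematical content is the harmonic analysis of zonal functions on `S^{p-1}`; the rest is
bookkeeping of the mixture `h = ∑ 𝒫_{n+1} f^{⊗(n+1)}`.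

* Orthogonality. Differentiating the invariance of the surface measure under reflections gives the
  divergence theorem for tangential fields (`integral_tangential_derivative`), hence the symmetry of
  the spherical Laplacian on zonal polynomials about two possibly different axes
  (`integral_eval_mul_laplacian`). By the Gegenbauer equation (`legendrePoly_ode`) the zonal
  functions `P_ℓ(xᵀy)` are eigenfunctions, with eigenvalues depending injectively on `ℓ`, so those
  of different degrees are orthogonal whatever their axes (`integral_legendrePoly_mul_of_ne`). The
  three term recurrence then yields the norms, `c_{p,ℓ} ‖P_ℓ‖² = 1` (`normConst_mul_integral_sq`).
* Funk–Hecke (`funk_hecke`). For an integrable zonal `G`, the function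
  `x ↦ ∫ P_ℓ(xᵀy) G(zᵀy) dy` is continuous and zonal about `z`, and it is orthogonal to every
  `P_k(zᵀx)` with `k ≠ ℓ`. Zonal polynomials being uniformly dense in the continuous zonal functions,
  it is a multiple of `P_ℓ(zᵀx)`. Taking `G = P_ℓ` gives `|P_ℓ| ≤ 1` on `[-1,1]`.
* Consequently convolution multiplies Legendre coefficients, `f^{⊗n}` has the coefficients
  `f̂_ℓ^n` (`fourierCoeff_convPdf`), and summation over `n` turns the weights `𝒫_n` into a generating
  function, which is also a Laplace transform of the mixing law (`hasSum_poissonTransform_mul_pow`).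
* If `f` is square integrable, its expansion converges in `L²`
  (`tendsto_eLpNorm_fourierSum_sub`). As `f^{⊗2}(x)` is an `L²` inner product, it is at every `x` the
  sum of its expansion; at the pole this shows `∑ c_{p,ℓ} f̂_ℓ² < ∞`, and this series dominates the
  expansions of all `f^{⊗n}`, `n ≥ 2`, uniformly in `n` and `x`. Therefore `h - 𝒫_1 f` is everywhere
  the uniform sum of its expansion (`hasSum_convMix_sub`,
  `tendstoUniformly_fourierSum_convMix_sub`), and only the single-step term `𝒫_1 f` may
  fail to be recovered pointwise.
* The law of `x_t` follows by splitting according to the number of steps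
  (`IsCompoundCox.map_position`). Densities are first handled with values in `[0, ∞]` (`convLin`), so
  that the null sets on which the convolutions or their mixture diverge need no separate treatment.
-/

namespace CoxSphere

/-! ### The surface measure and its isometries -/

/-- The Euclidean space `ℝ^p`. -/
abbrev Euc (p : ℕ) : Type := EuclideanSpace ℝ (Fin p)

instance isFiniteMeasure_surf (p : ℕ) : IsFiniteMeasure (surf p) := by
  unfold surf; infer_instance

instance isOpenPosMeasure_surf (p : ℕ) : (surf p).IsOpenPosMeasure := by
  unfold surf; infer_instance

lemma surf_real_univ {p : ℕ} (hp : 2 ≤ p) : (surf p).real Set.univ = sphArea p := by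
  have : Nonempty (Fin p) := ⟨⟨0, by omega⟩⟩
  have hp0 : (p : ℝ) ≠ 0 := by positivity
  have h1 : (p : ℝ) / 2 ≠ 0 := by positivity
  have hG : Real.Gamma ((p : ℝ) / 2) ≠ 0 := (Real.Gamma_pos_of_pos (by positivity)).ne'
  rw [surf, Measure.toSphere_real_apply_univ, Measure.real, EuclideanSpace.volume_ball]
  simp only [finrank_euclideanSpace, Fintype.card_fin, ENNReal.ofReal_one, one_pow, one_mul]
  rw [ENNReal.toReal_ofReal (by positivity), Real.Gamma_add_one h1, sphArea,
    Real.sqrt_eq_rpow, ← Real.rpow_natCast, ← Real.rpow_mul Real.pi_pos.le]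
  rw [show (1 / 2 * (p : ℝ)) = p / 2 by ring]
  field_simp

lemma norm_coe_sph {p : ℕ} (x : Sph p) : ‖(x : Euc p)‖ = 1 := by
  simp

lemma dotp_comm {p : ℕ} (x y : Sph p) : dotp x y = dotp y x := real_inner_comm _ _

lemma dotp_self {p : ℕ} (x : Sph p) : dotp x x = 1 := by
  simp [dotp]

lemma dotp_mem {p : ℕ} (x y : Sph p) : dotp x y ∈ Set.Icc (-1 : ℝ) 1 := by
  have h := abs_real_inner_le_norm (x : Euc p) (y : Euc p)
  rw [norm_coe_sph, norm_coe_sph, one_mul] at h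
  exact abs_le.1 h

lemma continuous_dotp {p : ℕ} : Continuous fun q : Sph p × Sph p => dotp q.1 q.2 := by
  unfold dotp; fun_prop

lemma continuous_dotp_right {p : ℕ} (x : Sph p) : Continuous fun y => dotp x y :=
  continuous_dotp.comp (by fun_prop : Continuous fun y => (x, y))

lemma continuous_dotp_left {p : ℕ} (y : Sph p) : Continuous fun x => dotp x y :=
  continuous_dotp.comp (by fun_prop : Continuous fun x => (x, y))

/-- The action of a linear isometry of `ℝ^p` on the unit sphere. -/
noncomputable def sphMap {p : ℕ} (U : Euc p ≃ₗᵢ[ℝ] Euc p) :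
    Sph p ≃ₜ Sph p where
  toFun x := ⟨U x, by simp⟩
  invFun x := ⟨U.symm x, by simp⟩
  left_inv x := by simp
  right_inv x := by simp
  continuous_toFun := by fun_prop
  continuous_invFun := by fun_prop

lemma coe_sphMap {p : ℕ} (U : Euc p ≃ₗᵢ[ℝ] Euc p)
    (x : Sph p) : (sphMap U x : Euc p) = U x := rfl

lemma dotp_sphMap {p : ℕ} (U : Euc p ≃ₗᵢ[ℝ] Euc p)
    (x y : Sph p) : dotp (sphMap U x) (sphMap U y) = dotp x y := by
  simp [dotp, coe_sphMap]

open scoped Pointwise in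
lemma measurePreserving_sphMap {p : ℕ}
    (U : Euc p ≃ₗᵢ[ℝ] Euc p) :
    MeasurePreserving (sphMap U) (surf p) (surf p) := by
  refine ⟨(sphMap U).continuous.measurable, Measure.ext fun s hs => ?_⟩
  rw [Measure.map_apply (sphMap U).continuous.measurable hs, surf,
    Measure.toSphere_apply' _ hs,
    Measure.toSphere_apply' _ ((sphMap U).continuous.measurable hs)]
  congr 1
  rw [← U.measurePreserving.measure_preimage_emb U.toHomeomorph.measurableEmbedding
    (Set.Ioo (0 : ℝ) 1 • ((fun y : Sph p => (y : Euc p)) '' s))]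
  congr 1
  ext z
  simp only [Set.mem_smul, Set.mem_image, Set.mem_preimage]
  constructor
  · rintro ⟨r, hr, w, ⟨y, hy, rfl⟩, rfl⟩
    exact ⟨r, hr, _, ⟨_, hy, rfl⟩, by simp [coe_sphMap]⟩
  · rintro ⟨r, hr, w, ⟨y, hy, rfl⟩, h⟩
    refine ⟨r, hr, _, ⟨(sphMap U).symm y, by simpa using hy, rfl⟩, ?_⟩
    apply U.injective
    rw [← h, map_smul, ← coe_sphMap, Homeomorph.apply_symm_apply]

lemma integral_sphMap {p : ℕ} (U : Euc p ≃ₗᵢ[ℝ] Euc p)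
    (F : Sph p → ℝ) : ∫ y, F (sphMap U y) ∂(surf p) = ∫ y, F y ∂(surf p) :=
  (measurePreserving_sphMap U).integral_comp (sphMap U).measurableEmbedding F

/-- The reflection exchanging the unit vectors `x` and `x'`. It fixes every vector that has the
same inner product with both. -/
noncomputable def swapRefl {p : ℕ} (x x' : Sph p) :
    Euc p ≃ₗᵢ[ℝ] Euc p :=
  (ℝ ∙ ((x : Euc p) - x'))ᗮ.reflection

lemma sphMap_swapRefl {p : ℕ} (x x' : Sph p) : sphMap (swapRefl x x') x = x' :=
  Subtype.ext (Submodule.reflection_sub (by simp))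

lemma sphMap_swapRefl_of_dotp_eq {p : ℕ} {x x' y : Sph p} (h : dotp x y = dotp x' y) :
    sphMap (swapRefl x x') y = y := by
  refine Subtype.ext (Submodule.reflection_mem_subspace_eq_self ?_)
  rw [Submodule.mem_orthogonal_singleton_iff_inner_right, inner_sub_left]
  exact sub_eq_zero.2 h

/-- The integral of a zonal function does not depend on its axis. -/
lemma integral_dotp_eq {p : ℕ} (F : ℝ → ℝ) (x x' : Sph p) :
    ∫ y, F (dotp x y) ∂(surf p) = ∫ y, F (dotp x' y) ∂(surf p) := by
  rw [← integral_sphMap (swapRefl x x') fun y => F (dotp x' y)]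
  refine integral_congr_ae (Eventually.of_forall fun y => ?_)
  simp only
  rw [← dotp_sphMap (swapRefl x x') x y, sphMap_swapRefl]

/-- The convolution of two zonal kernels is zonal. -/
lemma integral_dotp_dotp_congr {p : ℕ} (F G : ℝ → ℝ) {x x' z : Sph p} (h : dotp x z = dotp x' z) :
    ∫ y, F (dotp x y) * G (dotp z y) ∂(surf p) = ∫ y, F (dotp x' y) * G (dotp z y) ∂(surf p) := by
  rw [← integral_sphMap (swapRefl x x') fun y => F (dotp x' y) * G (dotp z y)]
  refine integral_congr_ae (Eventually.of_forall fun y => ?_)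
  simp only
  rw [← dotp_sphMap (swapRefl x x') x y, sphMap_swapRefl, ← dotp_sphMap (swapRefl x x') z y,
    sphMap_swapRefl_of_dotp_eq h]

lemma integrable_of_continuous_sph {p : ℕ} {F : Sph p → ℝ} (hF : Continuous F) :
    Integrable F (surf p) :=
  hF.integrable_of_hasCompactSupport (HasCompactSupport.of_compactSpace F)

/-! ### Integration by parts on the sphere -/

/-- Infinitesimal rotation invariance in the plane of two orthonormal vectors: the derivative of
`ψ` along the rotation field `y ↦ ⟨b,y⟩ a - ⟨a,y⟩ b` has integral zero. It is obtained by
differentiating `∫ ψ(R_τ y) dy` in `τ`, where `R_τ` is the reflection in the hyperplane orthogonal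
to `cos τ a + sin τ b`. -/
lemma integral_rotation_field_of_orthonormal {p : ℕ} {ψ : Euc p → ℝ}
    {ψ' : Euc p → Euc p →L[ℝ] ℝ}
    (hψ : ∀ y, HasFDerivAt ψ (ψ' y) y) (hψ' : Continuous ψ') {a b : Euc p}
    (ha : ‖a‖ = 1) (hb : ‖b‖ = 1) (hab : inner ℝ a b = 0) :
    ∫ y : Sph p, ψ' y (inner ℝ b (y : Euc p) • a
      - inner ℝ a (y : Euc p) • b) ∂(surf p) = 0 := by
  set D : Sph p → ℝ := fun y => ψ' y (inner ℝ b (y : Euc p) • a - inner ℝ a (y : Euc p) • b) with hD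
  have hDc : Continuous D := by
    have : Continuous fun y : Sph p => ψ' (y : Euc p) := hψ'.comp continuous_subtype_val
    exact this.clm_apply (by fun_prop)
  have hψc : Continuous ψ := continuous_iff_continuousAt.2 fun y => (hψ y).continuousAt
  obtain ⟨C, hC⟩ : ∃ C, ∀ y, ‖D y‖ ≤ C := by
    obtain ⟨C, hC⟩ := (isCompact_range hDc).isBounded.exists_norm_le
    exact ⟨C, fun y => hC _ ⟨y, rfl⟩⟩
  -- The rotating unit normal `c τ` and its derivative `c' τ`, an orthonormal pair.
  set c : ℝ → Euc p := fun τ => Real.cos τ • a + Real.sin τ • b with hc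
  set c' : ℝ → Euc p := fun τ => -Real.sin τ • a + Real.cos τ • b with hc'
  have haa : inner ℝ a a = (1 : ℝ) := by rw [real_inner_self_eq_norm_sq, ha, one_pow]
  have hbb : inner ℝ b b = (1 : ℝ) := by rw [real_inner_self_eq_norm_sq, hb, one_pow]
  have hba : inner ℝ b a = (0 : ℝ) := by rw [real_inner_comm, hab]
  have hcc : ∀ τ, inner ℝ (c τ) (c τ) = (1 : ℝ) := fun τ => by
    simp only [hc, inner_add_left, inner_add_right, real_inner_smul_left, real_inner_smul_right,
      haa, hbb, hab, hba]
    linear_combination Real.sin_sq_add_cos_sq τ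
  have hc'c : ∀ τ, inner ℝ (c' τ) (c τ) = (0 : ℝ) := fun τ => by
    simp only [hc, hc', inner_add_left, inner_add_right, real_inner_smul_left,
      real_inner_smul_right, haa, hbb, hab, hba]
    ring
  have hcd : ∀ τ, HasDerivAt c (c' τ) τ := fun τ =>
    ((Real.hasDerivAt_cos τ).smul_const a).add ((Real.hasDerivAt_sin τ).smul_const b)
  set R : ℝ → Euc p ≃ₗᵢ[ℝ] Euc p := fun τ => (ℝ ∙ c τ)ᗮ.reflection with hR
  have hRy : ∀ τ y, R τ y = y - (2 * inner ℝ (c τ) y) • c τ := fun τ y => by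
    rw [hR]
    simp only
    rw [Submodule.reflection_orthogonal_apply, Submodule.reflection_singleton_apply]
    have : ‖c τ‖ ^ 2 = 1 := by rw [← real_inner_self_eq_norm_sq, hcc]
    simp only [RCLike.ofReal_real_eq_id, id_eq, this, div_one, two_smul]
    rw [two_mul, add_smul]
    abel
  have hder : ∀ (y : Sph p) (τ : ℝ),
      HasDerivAt (fun τ => ψ (R τ y)) (-2 * D (sphMap (R τ) y)) τ := by
    intro y τ
    have h1 : HasDerivAt (fun τ => R τ y)
        (-((2 * inner ℝ (c τ) (y : Euc p)) • c' τ + (2 * inner ℝ (c' τ) (y : Euc p)) • c τ)) τ := by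
      have h2 : HasDerivAt (fun τ => inner ℝ (c τ) (y : Euc p)) (inner ℝ (c' τ) (y : Euc p)) τ := by
        simpa using (hcd τ).inner ℝ (hasDerivAt_const τ (y : Euc p))
      have h3 := ((h2.const_mul 2).smul (hcd τ)).const_sub (y : Euc p)
      exact h3.congr_of_eventuallyEq (Eventually.of_forall fun τ => hRy τ y)
    have h2 := (hψ (R τ y)).comp_hasDerivAt τ h1
    have e1 : inner ℝ (c τ) (R τ y) = -inner ℝ (c τ) (y : Euc p) := by
      rw [hRy, inner_sub_right, real_inner_smul_right, hcc]; ring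
    have e2 : inner ℝ (c' τ) (R τ y) = inner ℝ (c' τ) (y : Euc p) := by
      rw [hRy, inner_sub_right, real_inner_smul_right, hc'c]; ring
    -- The rotation field does not depend on the orthonormal frame chosen in its plane.
    have e3 : inner ℝ b (R τ y) • a - inner ℝ a (R τ y) • b
        = inner ℝ (c' τ) (R τ y) • c τ - inner ℝ (c τ) (R τ y) • c' τ := by
      simp only [hc, hc', inner_add_left, real_inner_smul_left]
      match_scalars
      · linear_combination (-inner ℝ b (R τ y)) * Real.sin_sq_add_cos_sq τ
      · linear_combination (inner ℝ a (R τ y)) * Real.sin_sq_add_cos_sq τ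
    refine h2.congr_deriv ?_
    rw [hD]
    simp only [coe_sphMap]
    rw [← smul_eq_mul (-2 : ℝ), ← map_smul, e3, e1, e2]
    congr 1
    module
  have hcont : ∀ τ, Continuous fun y : Sph p => ψ (R τ y) := fun τ => by fun_prop
  have key := hasDerivAt_integral_of_dominated_loc_of_deriv_le (μ := surf p)
    (F := fun τ (y : Sph p) => ψ (R τ y)) (F' := fun τ y => -2 * D (sphMap (R τ) y))
    (x₀ := 0) (s := Set.univ) (bound := fun _ => 2 * C) Filter.univ_mem
    (Eventually.of_forall fun τ => (hcont τ).aestronglyMeasurable)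
    (integrable_of_continuous_sph (hcont 0))
    (((hDc.comp (sphMap (R 0)).continuous).const_mul (-2)).aestronglyMeasurable)
    (Eventually.of_forall fun y τ _ => by
      rw [norm_mul]; norm_num; exact hC _)
    (integrable_const _)
    (Eventually.of_forall fun y τ _ => hder y τ)
  have hconst : (fun τ => ∫ y : Sph p, ψ (R τ y) ∂(surf p))
      = fun _ => ∫ y : Sph p, ψ y ∂(surf p) := by
    funext τ
    exact integral_sphMap (R τ) fun y => ψ y
  have h0 := key.2
  rw [hconst] at h0
  have h1 := h0.unique (hasDerivAt_const (0 : ℝ) _)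
  rw [integral_const_mul, integral_sphMap (R 0) D] at h1
  simpa using h1

lemma integral_rotation_field {p : ℕ} {ψ : Euc p → ℝ}
    {ψ' : Euc p → Euc p →L[ℝ] ℝ}
    (hψ : ∀ y, HasFDerivAt ψ (ψ' y) y) (hψ' : Continuous ψ') {a : Euc p}
    (ha : ‖a‖ = 1) (b : Euc p) :
    ∫ y : Sph p, ψ' y (inner ℝ b (y : Euc p) • a
      - inner ℝ a (y : Euc p) • b) ∂(surf p) = 0 := by
  have haa : inner ℝ a a = (1 : ℝ) := by rw [real_inner_self_eq_norm_sq, ha, one_pow]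
  -- The field vanishes for `b = a`, so only the part `d` of `b` orthogonal to `a` counts.
  set α := inner ℝ a b with hα
  set d := b - α • a with hd
  have hb : b = α • a + d := by rw [hd]; abel
  have had : inner ℝ a d = (0 : ℝ) := by
    rw [hd, inner_sub_right, real_inner_smul_right, haa, ← hα]; ring
  have hfield : ∀ y : Euc p,
      inner ℝ b y • a - inner ℝ a y • b = inner ℝ d y • a - inner ℝ a y • d := by
    intro y
    rw [hb]
    simp only [inner_add_left, real_inner_smul_left]
    module
  simp only [hfield]
  by_cases hd0 : d = 0
  · simp [hd0]
  have hdn : ‖d‖ ≠ 0 := norm_ne_zero_iff.2 hd0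
  have key := integral_rotation_field_of_orthonormal hψ hψ' (b := ‖d‖⁻¹ • d) ha
    (by rw [norm_smul, norm_inv, norm_norm, inv_mul_cancel₀ hdn])
    (by rw [real_inner_smul_right, had, mul_zero])
  have e : ∀ y : Euc p, inner ℝ d y • a - inner ℝ a y • d
      = ‖d‖ • (inner ℝ (‖d‖⁻¹ • d) y • a - inner ℝ a y • (‖d‖⁻¹ • d)) := by
    intro y
    simp only [real_inner_smul_left]
    match_scalars <;> field_simp
  simp only [e, map_smul, smul_eq_mul]
  rw [integral_const_mul, key, mul_zero]

/-- Divergence theorem for the tangential field `ψ(y) (a - ⟨a,y⟩ y)`, summed up from the rotations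
in the planes of `a` and the vectors of an orthonormal basis. -/
lemma integral_tangential_derivative {p : ℕ} {ψ : Euc p → ℝ}
    {ψ' : Euc p → Euc p →L[ℝ] ℝ}
    (hψ : ∀ y, HasFDerivAt ψ (ψ' y) y) (hψ' : Continuous ψ') (a : Sph p) :
    ∫ y : Sph p, ψ' y ((a : Euc p) - dotp a y • (y : Euc p))
        ∂(surf p)
      = ((p : ℝ) - 1) * ∫ y : Sph p, dotp a y * ψ y ∂(surf p) := by
  let e : OrthonormalBasis (Fin p) ℝ (Euc p) := EuclideanSpace.basisFun (Fin p) ℝ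
  have hψc : Continuous ψ := continuous_iff_continuousAt.2 fun y => (hψ y).continuousAt
  have hψs : Continuous fun y : Sph p => ψ y := hψc.comp continuous_subtype_val
  have hψ's : Continuous fun y : Sph p => ψ' y := hψ'.comp continuous_subtype_val
  -- The rotation field in the plane of `a` and `e j`.
  obtain ⟨V, hV⟩ : ∃ V : Fin p → Sph p → Euc p, V = fun j (y : Sph p) =>
    inner ℝ (e j) (y : Euc p) • (a : Euc p) - inner ℝ (a : Euc p) (y : Euc p) • e j := ⟨_, rfl⟩
  have hVc : ∀ j, Continuous (V j) := fun j => by rw [hV]; fun_prop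
  -- Differentiating `⟨e j, y⟩ ψ(y)` makes the weighted fields `⟨e j, y⟩ V j y` add up to the
  -- tangential projection of `a`.
  have hj : ∀ j, ∫ y : Sph p, (inner ℝ (e j) (y : Euc p) * ψ' y (V j y)
      + ψ y * inner ℝ (e j) (V j y))
      ∂(surf p) = 0 := by
    intro j
    have := integral_rotation_field (ψ := fun y => inner ℝ (e j) y * ψ y)
      (ψ' := fun y => inner ℝ (e j) y • ψ' y + ψ y • innerSL ℝ (e j))
      (fun y => by
        have h1 : HasFDerivAt (fun y => inner ℝ (e j) y) (innerSL ℝ (e j)) y :=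
          (innerSL ℝ (e j)).hasFDerivAt
        exact h1.mul (hψ y)) (by fun_prop) (norm_coe_sph a) (e j)
    rw [hV]
    simpa using this
  have hsum : ∑ j, ∫ y : Sph p, (inner ℝ (e j) (y : Euc p) * ψ' y (V j y)
      + ψ y * inner ℝ (e j) (V j y))
      ∂(surf p) = 0 := Finset.sum_eq_zero fun j _ => hj j
  rw [← integral_finsetSum _ fun j _ => integrable_of_continuous_sph (by
    refine Continuous.add (Continuous.mul (by fun_prop) (hψ's.clm_apply (hVc j))) ?_
    exact hψs.mul (continuous_const.inner (hVc j)))] at hsum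
  have hpt : ∀ y : Sph p, ∑ j, (inner ℝ (e j) (y : Euc p) * ψ' y (V j y)
      + ψ y * inner ℝ (e j) (V j y))
      = ψ' y ((a : Euc p) - dotp a y • (y : Euc p)) - ((p : ℝ) - 1) * (dotp a y * ψ y) := by
    intro y
    rw [Finset.sum_add_distrib]
    have h1 : ∑ j, inner ℝ (e j) (y : Euc p) * inner ℝ (e j) (y : Euc p) = (1 : ℝ) := by
      have := e.sum_inner_mul_inner (y : Euc p) (y : Euc p)
      rw [real_inner_self_eq_norm_sq, norm_coe_sph, one_pow] at this
      refine Eq.trans ?_ this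
      exact Finset.sum_congr rfl fun j _ => by rw [real_inner_comm (y : Euc p) (e j)]
    have h2 : ∑ j, inner ℝ (e j) (y : Euc p) • e j = (y : Euc p) := e.sum_repr' (y : Euc p)
    have h3 : ∑ j, inner ℝ (e j) (y : Euc p) * inner ℝ (e j) (a : Euc p) = dotp a y := by
      have := e.sum_inner_mul_inner (a : Euc p) (y : Euc p)
      rw [dotp, ← this]
      exact Finset.sum_congr rfl fun j _ => by rw [real_inner_comm (a : Euc p) (e j), mul_comm]
    have hee : ∀ j, inner ℝ (e j) (e j) = (1 : ℝ) := fun j => by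
      rw [real_inner_self_eq_norm_sq, e.norm_eq_one, one_pow]
    have hA : ∑ j, inner ℝ (e j) (y : Euc p) * ψ' y (V j y)
        = ψ' y ((a : Euc p) - dotp a y • (y : Euc p)) := by
      simp only [← smul_eq_mul, ← map_smul]
      rw [← map_sum]
      congr 1
      have : ∀ j, inner ℝ (e j) (y : Euc p) • V j y
          = (inner ℝ (e j) (y : Euc p) * inner ℝ (e j) (y : Euc p)) • (a : Euc p)
            - dotp a y • (inner ℝ (e j) (y : Euc p) • e j) := fun j => by
        rw [hV, dotp]; module
      simp only [this]
      rw [Finset.sum_sub_distrib, ← Finset.sum_smul, ← Finset.smul_sum, h1, h2, one_smul]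
    have hB : ∑ j, ψ y * inner ℝ (e j) (V j y)
        = ψ y * (dotp a y - p * dotp a y) := by
      rw [← Finset.mul_sum]
      congr 1
      simp only [hV, inner_sub_right, real_inner_smul_right, hee]
      rw [Finset.sum_sub_distrib, h3]
      simp [dotp]
    rw [hA, hB]
    ring
  simp only [hpt] at hsum
  rw [integral_sub, integral_const_mul] at hsum
  · linarith
  · exact integrable_of_continuous_sph (hψ's.clm_apply (by unfold dotp; fun_prop))
  · exact integrable_of_continuous_sph
      (((continuous_dotp_right a).mul hψs).const_mul _)

/-! ### Legendre polynomials in dimension `p` -/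

open Polynomial in
/-- The Legendre polynomial in dimension `p` as an element of `ℝ[X]`, by the recurrence
`(ℓ+p-2) P_{ℓ+1} = (2ℓ+p-2) X P_ℓ - ℓ P_{ℓ-1}`, which for `p ≥ 2` is free of degeneracies. -/
noncomputable def legendrePoly (p : ℕ) : ℕ → ℝ[X]
  | 0 => 1
  | 1 => X
  | n + 2 => C (((n : ℝ) + p - 1)⁻¹) *
      (C (2 * (n : ℝ) + p) * X * legendrePoly p (n + 1) - C ((n : ℝ) + 1) * legendrePoly p n)

lemma legendrePoly_zero (p : ℕ) : legendrePoly p 0 = 1 := by rw [legendrePoly]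

lemma legendrePoly_one (p : ℕ) : legendrePoly p 1 = Polynomial.X := by rw [legendrePoly]

open Polynomial in
lemma legendrePoly_add_two {p : ℕ} (hp : 2 ≤ p) (n : ℕ) :
    C ((n : ℝ) + p - 1) * legendrePoly p (n + 2)
      = C (2 * (n : ℝ) + p) * X * legendrePoly p (n + 1) - C ((n : ℝ) + 1) * legendrePoly p n := by
  have hp' : (2 : ℝ) ≤ p := by exact_mod_cast hp
  have h : ((n : ℝ) + p - 1) ≠ 0 := by
    have := n.cast_nonneg (α := ℝ); intro h; linarith
  rw [legendrePoly, ← mul_assoc, ← C_mul, mul_inv_cancel₀ h, C_1, one_mul]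

/-- The value at `1` of the Gegenbauer polynomial of index `(p-2)/2`. -/
lemma gegenbauer_normalizer_succ {p : ℕ} (hp : 3 ≤ p) (n : ℕ) :
    Real.Gamma (((n + 1 : ℕ) : ℝ) + p - 2)
        / ((((n + 1).factorial : ℕ) : ℝ) * Real.Gamma ((p : ℝ) - 2))
      = ((n : ℝ) + p - 2) / (n + 1)
        * (Real.Gamma ((n : ℝ) + p - 2) / ((n.factorial : ℝ) * Real.Gamma ((p : ℝ) - 2))) := by
  have hp' : (3 : ℝ) ≤ p := by exact_mod_cast hp
  have hn := n.cast_nonneg (α := ℝ)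
  have h : ((n : ℝ) + p - 2) ≠ 0 := by intro h; linarith
  have h1 : ((n + 1 : ℕ) : ℝ) + p - 2 = ((n : ℝ) + p - 2) + 1 := by push_cast; ring
  rw [h1, Real.Gamma_add_one h, Nat.factorial_succ]
  push_cast
  have : Real.Gamma ((p : ℝ) - 2) ≠ 0 := (Real.Gamma_pos_of_pos (by linarith)).ne'
  have : (n : ℝ) + 1 ≠ 0 := by positivity
  have : (n.factorial : ℝ) ≠ 0 := by positivity
  field_simp

lemma legendreP_eq_eval {p : ℕ} (hp : 2 ≤ p) (ℓ : ℕ) (s : ℝ) :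
    legendreP p ℓ s = (legendrePoly p ℓ).eval s := by
  rcases hp.eq_or_lt with rfl | hp3
  · induction ℓ using Nat.twoStepInduction with
    | zero => simp [legendreP, legendrePoly_zero]
    | one => simp [legendreP, legendrePoly_one]
    | more n h0 h1 =>
      simp only [legendreP, if_true] at h0 h1 ⊢
      have h := congrArg (Polynomial.eval s) (legendrePoly_add_two le_rfl n)
      simp only [Polynomial.eval_mul, Polynomial.eval_C, Polynomial.eval_sub,
        Polynomial.eval_X, ← h0, ← h1] at h
      have hn : (n : ℝ) + 1 ≠ 0 := by positivity
      rw [← mul_right_inj' hn]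
      push_cast at h ⊢
      rw [Polynomial.Chebyshev.T_add_two]
      simp only [Polynomial.eval_mul, Polynomial.eval_sub, Polynomial.eval_X,
        Polynomial.eval_ofNat]
      linear_combination -h
  · have hp3 : 3 ≤ p := hp3
    have hp' : (3 : ℝ) ≤ p := by exact_mod_cast hp3
    have hG : Real.Gamma ((p : ℝ) - 2) ≠ 0 := (Real.Gamma_pos_of_pos (by linarith)).ne'
    obtain ⟨K, hK⟩ : ∃ K : ℕ → ℝ, K = fun n : ℕ =>
      Real.Gamma ((n : ℝ) + p - 2) / ((n.factorial : ℝ) * Real.Gamma ((p : ℝ) - 2)) := ⟨_, rfl⟩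
    have hKpos : ∀ n, 0 < K n := fun n => by
      have hn := n.cast_nonneg (α := ℝ)
      have := Real.Gamma_pos_of_pos (s := (n : ℝ) + p - 2) (by linarith)
      have := Real.Gamma_pos_of_pos (s := (p : ℝ) - 2) (by linarith)
      rw [hK]; positivity
    have hKs : ∀ n : ℕ, K (n + 1) = ((n : ℝ) + p - 2) / (n + 1) * K n := fun n => by
      rw [hK]; exact gegenbauer_normalizer_succ hp3 n
    have hK0 : K 0 = 1 := by simp [hK, div_self hG]
    have hmain : gegenbauer (((p : ℝ) - 2) / 2) ℓ s = K ℓ * (legendrePoly p ℓ).eval s := by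
      induction ℓ using Nat.twoStepInduction with
      | zero => simp [gegenbauer, legendrePoly_zero, hK0]
      | one =>
        have := hKs 0
        simp only [zero_add, Nat.cast_zero, hK0] at this
        simp only [gegenbauer, legendrePoly_one, Polynomial.eval_X, this]
        ring
      | more n h0 h1 =>
        have h := congrArg (Polynomial.eval s) (legendrePoly_add_two hp n)
        simp only [Polynomial.eval_mul, Polynomial.eval_C, Polynomial.eval_sub,
          Polynomial.eval_X] at h
        rw [gegenbauer, h0, h1, hKs (n + 1), hKs n]
        have hn : (n : ℝ) + 1 ≠ 0 := by positivity
        have hn2 : (n : ℝ) + 1 + 1 ≠ 0 := by positivity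
        have hn3 : (n : ℝ) + 2 ≠ 0 := by positivity
        push_cast
        field_simp
        linear_combination (-(K n * (n + p - 2) * (n + 2))) * h
    have hKℓ := congrFun hK ℓ
    rw [legendreP, if_neg (by omega), hmain, ← hKℓ, ← mul_assoc,
      inv_mul_cancel₀ (hKpos ℓ).ne', one_mul]

open Polynomial in
/-- `(1 - X²) P_{ℓ+1}' = (ℓ+1) (P_ℓ - X P_{ℓ+1})`. -/
lemma one_sub_sq_mul_derivative_legendrePoly {p : ℕ} (hp : 2 ≤ p) (n : ℕ) :
    (1 - X ^ 2) * derivative (legendrePoly p (n + 1))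
      = C ((n : ℝ) + 1) * (legendrePoly p n - X * legendrePoly p (n + 1)) := by
  have hp' : (2 : ℝ) ≤ p := by exact_mod_cast hp
  induction n using Nat.twoStepInduction with
  | zero => simp [legendrePoly_zero, legendrePoly_one]; ring
  | one =>
    have h := legendrePoly_add_two hp 0
    have hd := congrArg derivative h
    have hne : (C ((p : ℝ) - 1) : ℝ[X]) ≠ 0 := by
      rw [Ne, C_eq_zero]; intro h; linarith
    apply mul_left_cancel₀ hne
    simp only [legendrePoly_zero, legendrePoly_one, derivative_mul, derivative_X, derivative_one,
      map_add, map_sub, map_mul, map_one, map_natCast, map_ofNat,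
      Nat.cast_zero, Nat.cast_one, map_zero, zero_add] at h hd ⊢
    simp at hd
    linear_combination (1 - X ^ 2) * hd + 2 * X * h
  | more n h0 h1 =>
    have h := legendrePoly_add_two hp (n + 1)
    have h' := legendrePoly_add_two hp n
    have hd := congrArg derivative h
    have hne : (C ((n : ℝ) + p) : ℝ[X]) ≠ 0 := by
      rw [Ne, C_eq_zero]; intro h; have := n.cast_nonneg (α := ℝ); linarith
    apply mul_left_cancel₀ hne
    rw [derivative_mul, derivative_sub, derivative_mul, derivative_mul, derivative_mul] at hd
    simp only [derivative_C] at hd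
    simp only [derivative_X, map_add, map_sub, map_mul, map_one, map_natCast, map_ofNat,
      Nat.cast_add, Nat.cast_ofNat, Nat.cast_one] at h h' hd h0 h1 ⊢
    linear_combination (1 - X ^ 2) * hd + (2 * (n + 1) + (p : ℝ[X])) * X * h1 - (n + 2) * h0
      + (n + 3) * X * h - (n + 2) * h'

open Polynomial in
/-- The Gegenbauer differential equation
`(1 - X²) P_ℓ'' - (p-1) X P_ℓ' + ℓ (ℓ+p-2) P_ℓ = 0`. -/
lemma legendrePoly_ode {p : ℕ} (hp : 2 ≤ p) (n : ℕ) :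
    (1 - X ^ 2) * derivative (derivative (legendrePoly p n))
        - C ((p : ℝ) - 1) * X * derivative (legendrePoly p n)
      = -(C ((n : ℝ) * ((n : ℝ) + p - 2)) * legendrePoly p n) := by
  rcases n with _ | _ | n
  · simp [legendrePoly_zero]
  · simp only [legendrePoly_one, derivative_X, derivative_one, map_add, map_sub, map_mul, map_one,
      map_natCast, map_ofNat, zero_add, Nat.cast_one]
    ring
  · have h0 := one_sub_sq_mul_derivative_legendrePoly hp n
    have h1 := one_sub_sq_mul_derivative_legendrePoly hp (n + 1)
    have h := legendrePoly_add_two hp n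
    have hd := congrArg derivative h1
    -- After multiplication by `1 - X²` all derivatives can be eliminated.
    have hne : (1 - X ^ 2 : ℝ[X]) ≠ 0 := by
      intro h
      have := congrArg (eval 0) h
      simp at this
    apply mul_left_cancel₀ hne
    rw [derivative_mul, derivative_mul, derivative_sub, derivative_sub, derivative_mul] at hd
    simp only [derivative_C, derivative_one, derivative_X, derivative_X_pow] at hd
    simp only [map_add, map_sub, map_mul, map_one, map_natCast, map_ofNat,
      Nat.cast_add, Nat.cast_ofNat, Nat.cast_one] at h hd h0 h1 ⊢
    linear_combination (1 - X ^ 2) * hd + (n + 2) * h0 + (-(n + 2) - (p : ℝ[X]) + 3) * X * h1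
      + (n + 2) * h

open Polynomial in
/-- The Legendre polynomials span all polynomials, with control of the degree. -/
lemma X_pow_mem_span_legendrePoly {p : ℕ} (hp : 2 ≤ p) (n : ℕ) :
    (X ^ n : ℝ[X]) ∈ Submodule.span ℝ (legendrePoly p '' Set.Iic n) := by
  have hp' : (2 : ℝ) ≤ p := by exact_mod_cast hp
  induction n with
  | zero =>
    rw [pow_zero, ← legendrePoly_zero p]
    exact Submodule.subset_span ⟨0, by simp, rfl⟩
  | succ n ih =>
    rw [pow_succ]
    refine Submodule.span_induction (p := fun q _ => q * X ∈
      Submodule.span ℝ (legendrePoly p '' Set.Iic (n + 1))) ?_ ?_ ?_ ?_ ih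
    · rintro _ ⟨k, hk, rfl⟩
      have hk : k ≤ n := hk
      have hmem : ∀ j, j ≤ n + 1 →
          legendrePoly p j ∈ Submodule.span ℝ (legendrePoly p '' Set.Iic (n + 1)) :=
        fun j hj => Submodule.subset_span ⟨j, hj, rfl⟩
      rcases k with _ | k
      · rw [legendrePoly_zero, one_mul, ← legendrePoly_one p]
        exact hmem 1 (by omega)
      · have h := legendrePoly_add_two hp k
        have hne : (2 * (k : ℝ) + p) ≠ 0 := by positivity
        have e : legendrePoly p (k + 1) * X
            = ((2 * (k : ℝ) + p)⁻¹ * ((k : ℝ) + p - 1)) • legendrePoly p (k + 2)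
              + ((2 * (k : ℝ) + p)⁻¹ * ((k : ℝ) + 1)) • legendrePoly p k := by
          rw [mul_smul, mul_smul, ← smul_add, smul_eq_C_mul, smul_eq_C_mul, h, smul_eq_C_mul,
            sub_add_cancel, mul_assoc, ← mul_assoc, ← C_mul, inv_mul_cancel₀ hne, C_1, one_mul,
            mul_comm]
        rw [e]
        exact add_mem (Submodule.smul_mem _ _ (hmem _ (by omega)))
          (Submodule.smul_mem _ _ (hmem _ (by omega)))
    · simp
    · intro a b _ _ ha hb
      rw [add_mul]; exact add_mem ha hb
    · intro c a _ ha
      rw [smul_mul_assoc]; exact Submodule.smul_mem _ _ ha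

open Polynomial in
lemma mem_span_legendrePoly {p : ℕ} (hp : 2 ≤ p) (q : ℝ[X]) {L : ℕ} (hL : q.natDegree < L) :
    q ∈ Submodule.span ℝ (legendrePoly p '' Set.Iio L) := by
  rw [q.as_sum_range_C_mul_X_pow]
  refine sum_mem fun i hi => ?_
  rw [← smul_eq_C_mul]
  refine Submodule.smul_mem _ _ (Submodule.span_mono (Set.image_mono ?_)
    (X_pow_mem_span_legendrePoly hp i))
  intro j hj
  have := Finset.mem_range.1 hi
  have : j ≤ i := hj
  exact Set.mem_Iio.2 (by omega)

/-! ### Orthogonality -/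

lemma continuous_eval_dotp {p : ℕ} (q : Polynomial ℝ) (x : Sph p) :
    Continuous fun y => q.eval (dotp x y) :=
  q.continuous.comp (continuous_dotp_right x)

open Polynomial in
/-- The weak form of the spherical Laplacian on zonal functions about two axes. The right-hand side
is symmetric in `(x, q)` and `(z, r)`. -/
lemma integral_eval_mul_laplacian {p : ℕ} (q r : ℝ[X]) (x z : Sph p) :
    ∫ y, q.eval (dotp x y) * ((1 - X ^ 2) * derivative (derivative r)
        - C ((p : ℝ) - 1) * X * derivative r).eval (dotp z y) ∂(surf p)
      = -∫ y, (derivative q).eval (dotp x y) * (derivative r).eval (dotp z y)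
          * (dotp x z - dotp x y * dotp z y) ∂(surf p) := by
  have h := integral_tangential_derivative
    (ψ := fun y : Euc p =>
      q.eval (inner ℝ (x : Euc p) y) * (derivative r).eval (inner ℝ (z : Euc p) y))
    (ψ' := fun y : Euc p => q.eval (inner ℝ (x : Euc p) y) •
        ((derivative (derivative r)).eval (inner ℝ (z : Euc p) y) • innerSL ℝ (z : Euc p))
      + (derivative r).eval (inner ℝ (z : Euc p) y) •
        ((derivative q).eval (inner ℝ (x : Euc p) y) • innerSL ℝ (x : Euc p)))
    (fun y => by
      have hx : HasFDerivAt (fun y => inner ℝ (x : Euc p) y) (innerSL ℝ (x : Euc p)) y :=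
        (innerSL ℝ (x : Euc p)).hasFDerivAt
      have hz : HasFDerivAt (fun y => inner ℝ (z : Euc p) y) (innerSL ℝ (z : Euc p)) y :=
        (innerSL ℝ (z : Euc p)).hasFDerivAt
      exact ((q.hasDerivAt _).comp_hasFDerivAt y hx).mul
        (((derivative r).hasDerivAt _).comp_hasFDerivAt y hz))
    (by fun_prop) z
  have i1 : Integrable (fun y => q.eval (dotp x y) * ((1 - X ^ 2) * derivative (derivative r)
        - C ((p : ℝ) - 1) * X * derivative r).eval (dotp z y)) (surf p) :=
    integrable_of_continuous_sph ((continuous_eval_dotp _ x).mul (continuous_eval_dotp _ z))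
  have i2 : Integrable (fun y => (derivative q).eval (dotp x y) * (derivative r).eval (dotp z y)
          * (dotp x z - dotp x y * dotp z y)) (surf p) :=
    integrable_of_continuous_sph (((continuous_eval_dotp _ x).mul (continuous_eval_dotp _ z)).mul
      (continuous_const.sub ((continuous_dotp_right x).mul (continuous_dotp_right z))))
  rw [← integral_const_mul, ← sub_eq_zero, ← integral_sub] at h
  · rw [eq_neg_iff_add_eq_zero, ← integral_add i1 i2, ← h]
    refine integral_congr_ae (Eventually.of_forall fun y => ?_)
    simp [dotp, inner_sub_right, real_inner_smul_right]
    ring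
  · refine integrable_of_continuous_sph ?_
    unfold dotp
    fun_prop
  · refine integrable_of_continuous_sph ?_
    unfold dotp
    fun_prop

/-- Zonal Legendre polynomials of different degrees are orthogonal, even about different axes:
they are eigenfunctions of the symmetric spherical Laplacian for different eigenvalues. -/
lemma integral_legendrePoly_mul_of_ne {p : ℕ} (hp : 2 ≤ p) {k l : ℕ} (hkl : k ≠ l) (x z : Sph p) :
    ∫ y, (legendrePoly p k).eval (dotp x y) * (legendrePoly p l).eval (dotp z y) ∂(surf p) = 0 := by
  have hp' : (2 : ℝ) ≤ p := by exact_mod_cast hp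
  have h1 := integral_eval_mul_laplacian (legendrePoly p k) (legendrePoly p l) x z
  have h2 := integral_eval_mul_laplacian (legendrePoly p l) (legendrePoly p k) z x
  rw [legendrePoly_ode hp] at h1 h2
  have e : ∫ y, (Polynomial.derivative (legendrePoly p k)).eval (dotp x y)
          * (Polynomial.derivative (legendrePoly p l)).eval (dotp z y)
          * (dotp x z - dotp x y * dotp z y) ∂(surf p)
      = ∫ y, (Polynomial.derivative (legendrePoly p l)).eval (dotp z y)
          * (Polynomial.derivative (legendrePoly p k)).eval (dotp x y)
          * (dotp z x - dotp z y * dotp x y) ∂(surf p) := by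
    refine integral_congr_ae (Eventually.of_forall fun y => ?_)
    simp only [dotp_comm z x]
    ring
  rw [e, ← h2] at h1
  simp only [Polynomial.eval_neg, Polynomial.eval_mul, Polynomial.eval_C, mul_neg, integral_neg,
    mul_left_comm _ ((_ : ℝ) * _) _, integral_const_mul, neg_inj] at h1
  simp only [mul_comm (Polynomial.eval (dotp z _) _)] at h1
  have h3 : ((l : ℝ) - k) * ((l : ℝ) + k + p - 2) *
      ∫ y, (legendrePoly p k).eval (dotp x y) * (legendrePoly p l).eval (dotp z y) ∂(surf p)
        = 0 := by
    linear_combination h1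
  have hne : ((l : ℝ) - k) * ((l : ℝ) + k + p - 2) ≠ 0 := by
    refine mul_ne_zero (sub_ne_zero.2 (by exact_mod_cast hkl.symm)) ?_
    have : (1 : ℝ) ≤ l + k := by
      have : 1 ≤ l + k := by omega
      exact_mod_cast this
    intro h; linarith
  exact (mul_eq_zero.1 h3).resolve_left hne

/-! ### Norms of the Legendre polynomials -/

lemma integrable_eval_mul_eval {p : ℕ} (q r : Polynomial ℝ) (x z : Sph p) :
    Integrable (fun y => q.eval (dotp x y) * r.eval (dotp z y)) (surf p) :=
  integrable_of_continuous_sph ((continuous_eval_dotp q x).mul (continuous_eval_dotp r z))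

/-- The recurrence of the Legendre polynomials, integrated against a polynomial. -/
lemma integral_legendrePoly_recurrence {p : ℕ} (hp : 2 ≤ p) (n : ℕ) (r : Polynomial ℝ)
    (x : Sph p) :
    ((n : ℝ) + p - 1)
        * ∫ y, (legendrePoly p (n + 2)).eval (dotp x y) * r.eval (dotp x y) ∂(surf p)
      = (2 * (n : ℝ) + p) * ∫ y, (Polynomial.X * legendrePoly p (n + 1)).eval (dotp x y)
          * r.eval (dotp x y) ∂(surf p)
        - ((n : ℝ) + 1)
          * ∫ y, (legendrePoly p n).eval (dotp x y) * r.eval (dotp x y) ∂(surf p) := by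
  rw [← integral_const_mul, ← integral_const_mul, ← integral_const_mul, ← integral_sub
    ((integrable_eval_mul_eval _ _ x x).const_mul _)
    ((integrable_eval_mul_eval _ _ x x).const_mul _)]
  refine integral_congr_ae (Eventually.of_forall fun y => ?_)
  have h := congrArg (Polynomial.eval (dotp x y)) (legendrePoly_add_two hp n)
  simp only [Polynomial.eval_mul, Polynomial.eval_C, Polynomial.eval_sub,
    Polynomial.eval_X] at h ⊢
  linear_combination r.eval (dotp x y) * h

lemma normConst_zero (p : ℕ) : normConst p 0 = 1 / sphArea p := by simp [normConst]

lemma sphArea_pos {p : ℕ} (hp : 2 ≤ p) : 0 < sphArea p := by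
  have hp' : (2 : ℝ) ≤ p := by exact_mod_cast hp
  have := Real.Gamma_pos_of_pos (s := (p : ℝ) / 2) (by linarith)
  have := Real.pi_pos
  unfold sphArea; positivity

lemma normConst_one {p : ℕ} (hp : 2 ≤ p) : normConst p 1 = 1 / sphArea p * p := by
  have hp' : (2 : ℝ) ≤ p := by exact_mod_cast hp
  have hG : Real.Gamma ((p : ℝ) - 1) ≠ 0 := (Real.Gamma_pos_of_pos (by linarith)).ne'
  rw [normConst, if_neg one_ne_zero]
  rw [show ((1 : ℕ) : ℝ) + p - 2 = p - 1 by push_cast; ring]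
  simp only [Nat.factorial_one, Nat.cast_one]
  field_simp
  ring

lemma normConst_add_two {p : ℕ} (hp : 2 ≤ p) (n : ℕ) :
    normConst p (n + 2) = (2 * (n : ℝ) + 2 + p) * ((n : ℝ) + p - 1)
      / ((2 * (n : ℝ) + p) * ((n : ℝ) + 2)) * normConst p (n + 1) := by
  have hp' : (2 : ℝ) ≤ p := by exact_mod_cast hp
  have hn := n.cast_nonneg (α := ℝ)
  have hA := (sphArea_pos hp).ne'
  have hG : Real.Gamma ((p : ℝ) - 1) ≠ 0 := (Real.Gamma_pos_of_pos (by linarith)).ne'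
  have h1 : ((n : ℝ) + p - 1) ≠ 0 := by intro h; linarith
  rw [normConst, normConst, if_neg (by omega), if_neg (by omega)]
  rw [show ((n + 2 : ℕ) : ℝ) + p - 2 = ((n : ℝ) + p - 1) + 1 by push_cast; ring,
    Real.Gamma_add_one h1,
    show ((n + 1 : ℕ) : ℝ) + p - 2 = (n : ℝ) + p - 1 by push_cast; ring,
    Nat.factorial_succ (n + 1)]
  have h2 : (2 * (n : ℝ) + p) ≠ 0 := by positivity
  have h3 : ((n + 1).factorial : ℝ) ≠ 0 := by positivity
  push_cast
  have h4 : (n : ℝ) + 2 ≠ 0 := by positivity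
  have h5 : (n : ℝ) + 1 + 1 ≠ 0 := by positivity
  field_simp
  ring

/-- The normalizing constant `c_{p,ℓ}` is the inverse of the squared norm of `P_ℓ`. -/
lemma normConst_mul_integral_sq {p : ℕ} (hp : 2 ≤ p) (ℓ : ℕ) (x : Sph p) :
    normConst p ℓ
      * ∫ y, (legendrePoly p ℓ).eval (dotp x y) * (legendrePoly p ℓ).eval (dotp x y) ∂(surf p)
      = 1 := by
  have hp' : (2 : ℝ) ≤ p := by exact_mod_cast hp
  have hA := (sphArea_pos hp).ne'
  -- The squared norms and the off-diagonal Jacobi entries, linked by the recurrence.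
  set N : ℕ → ℝ := fun n =>
    ∫ y, (legendrePoly p n).eval (dotp x y) * (legendrePoly p n).eval (dotp x y) ∂(surf p) with hN
  set M : ℕ → ℝ := fun n => ∫ y, (Polynomial.X * legendrePoly p (n + 1)).eval (dotp x y)
    * (legendrePoly p n).eval (dotp x y) ∂(surf p) with hM
  have hMN : ∀ n : ℕ, (2 * (n : ℝ) + p) * M n = ((n : ℝ) + 1) * N n := fun n => by
    have := integral_legendrePoly_recurrence hp n (legendrePoly p n) x
    rw [integral_legendrePoly_mul_of_ne hp (by omega)] at this
    linear_combination -this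
  have hNM : ∀ n : ℕ, ((n : ℝ) + p - 1) * N (n + 2) = (2 * (n : ℝ) + p) * M (n + 1) := fun n => by
    have := integral_legendrePoly_recurrence hp n (legendrePoly p (n + 2)) x
    rw [integral_legendrePoly_mul_of_ne hp (by omega : n ≠ n + 2)] at this
    rw [hN, this, mul_zero, sub_zero]
    congr 1
    refine integral_congr_ae (Eventually.of_forall fun y => ?_)
    simp only [Polynomial.eval_mul, Polynomial.eval_X]
    ring
  have hN0 : N 0 = sphArea p := by
    simp [hN, legendrePoly_zero, ← surf_real_univ hp]
  have hN1 : N 1 = M 0 := by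
    refine integral_congr_ae (Eventually.of_forall fun y => ?_)
    simp [legendrePoly_zero, legendrePoly_one]
  change normConst p ℓ * N ℓ = 1
  rcases ℓ with _ | n
  · rw [normConst_zero, hN0]; field_simp
  · induction n with
    | zero =>
      have := hMN 0
      simp only [Nat.cast_zero, mul_zero, zero_add, one_mul, hN0, ← hN1] at this ⊢
      rw [normConst_one hp, mul_assoc, this]
      field_simp
    | succ n ih =>
      have hn := n.cast_nonneg (α := ℝ)
      have h1 : ((n : ℝ) + p - 1) ≠ 0 := by intro h; linarith
      have h2 : (2 * (n : ℝ) + p) ≠ 0 := by positivity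
      have h3 := hMN (n + 1)
      have h4 := hNM n
      push_cast at h3
      have h5 : (2 * (n : ℝ) + 2 + p) ≠ 0 := by positivity
      have h6 : (n : ℝ) + 2 ≠ 0 := by positivity
      rw [show n + 1 + 1 = n + 2 from rfl, normConst_add_two hp]
      have h7 : (2 * (n : ℝ) + 2 + p) * (((n : ℝ) + p - 1) * N (n + 2))
          = (2 * (n : ℝ) + p) * ((n : ℝ) + 2) * N (n + 1) := by
        rw [h4]; linear_combination (2 * (n : ℝ) + p) * h3
      calc _ = normConst p (n + 1) * ((2 * (n : ℝ) + 2 + p) * (((n : ℝ) + p - 1) * N (n + 2)))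
            / ((2 * (n : ℝ) + p) * ((n : ℝ) + 2)) := by field_simp
        _ = normConst p (n + 1) * N (n + 1) := by rw [h7]; field_simp
        _ = 1 := ih

lemma eval_one_legendrePoly {p : ℕ} (hp : 2 ≤ p) (ℓ : ℕ) : (legendrePoly p ℓ).eval 1 = 1 := by
  have hp' : (2 : ℝ) ≤ p := by exact_mod_cast hp
  induction ℓ using Nat.twoStepInduction with
  | zero => simp [legendrePoly_zero]
  | one => simp [legendrePoly_one]
  | more n h0 h1 =>
    have h := congrArg (Polynomial.eval 1) (legendrePoly_add_two hp n)
    simp only [Polynomial.eval_mul, Polynomial.eval_C, Polynomial.eval_sub, Polynomial.eval_X, h0,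
      h1] at h
    have hn := n.cast_nonneg (α := ℝ)
    have hne : ((n : ℝ) + p - 1) ≠ 0 := by intro h; linarith
    apply mul_left_cancel₀ hne
    linear_combination h

lemma integral_legendrePoly_sq_pos {p : ℕ} (hp : 2 ≤ p) (ℓ : ℕ) (x : Sph p) :
    0 < ∫ y, (legendrePoly p ℓ).eval (dotp x y) * (legendrePoly p ℓ).eval (dotp x y) ∂(surf p) := by
  have h := normConst_mul_integral_sq hp ℓ x
  refine lt_of_le_of_ne (integral_nonneg fun y => mul_self_nonneg _) fun h0 => ?_
  rw [← h0, mul_zero] at h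
  exact zero_ne_one h

lemma normConst_pos {p : ℕ} (hp : 2 ≤ p) (ℓ : ℕ) : 0 < normConst p ℓ := by
  have : Nonempty (Sph p) := by
    have : Nontrivial (Euc p) := by
      have : Nontrivial (Fin p) := Fin.nontrivial_iff_two_le.2 hp
      infer_instance
    exact (NormedSpace.sphere_nonempty.2 zero_le_one).to_subtype
  obtain ⟨x⟩ := this
  have h := normConst_mul_integral_sq hp ℓ x
  have h2 := integral_legendrePoly_sq_pos hp ℓ x
  by_contra hc
  nlinarith

/-! ### Zonal functions and the Funk–Hecke formula -/

lemma surjective_dotp {p : ℕ} (hp : 2 ≤ p) (z : Sph p) {s : ℝ} (hs : s ∈ Set.Icc (-1 : ℝ) 1) :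
    ∃ y : Sph p, dotp z y = s := by
  have hr : 1 < Module.rank ℝ (Euc p) := by
    rw [rank_eq_card_basis (EuclideanSpace.basisFun (Fin p) ℝ).toBasis, Fintype.card_fin]
    exact_mod_cast (by omega : 1 < p)
  have hc : PreconnectedSpace (Sph p) :=
    Subtype.preconnectedSpace (isPreconnected_sphere hr (0 : Euc p) 1)
  have h := hc.isPreconnected_univ.intermediate_value (Set.mem_univ (-z)) (Set.mem_univ z)
    (continuous_dotp_right z).continuousOn
  have h1 : dotp z (-z) = -1 := by
    have := dotp_self z
    unfold dotp at this ⊢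
    rw [coe_neg_sphere, inner_neg_right, this]
  rw [h1, dotp_self] at h
  obtain ⟨y, -, hy⟩ := h hs
  exact ⟨y, hy⟩

/-- A continuous zonal function is a uniform limit of zonal polynomials. -/
lemma exists_polynomial_near_zonal {p : ℕ} (hp : 2 ≤ p) (z : Sph p) {v : Sph p → ℝ}
    (hv : Continuous v) (hz : ∀ x x', dotp x z = dotp x' z → v x = v x') {ε : ℝ} (hε : 0 < ε) :
    ∃ q : Polynomial ℝ, ∀ y, |q.eval (dotp z y) - v y| < ε := by
  -- `v` factors continuously through the quotient map `y ↦ zᵀy` onto `[-1,1]`.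
  let d : Sph p → Set.Icc (-1 : ℝ) 1 := fun y => ⟨dotp z y, dotp_mem z y⟩
  have hd : Continuous d := (continuous_dotp_right z).subtype_mk _
  have hq : IsQuotientMap d := IsQuotientMap.of_surjective_continuous
    (fun s => by
      obtain ⟨y, hy⟩ := surjective_dotp hp z s.2
      exact ⟨y, Subtype.ext hy⟩) hd
  have hfac : Function.FactorsThrough v d := fun x x' h => by
    have h := congrArg Subtype.val h
    exact hz x x' (by rw [dotp_comm x, dotp_comm x']; exact h)
  let V : C(Set.Icc (-1 : ℝ) 1, ℝ) :=
    IsQuotientMap.lift (f := ⟨d, hd⟩) hq ⟨v, hv⟩ hfac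
  have hV : ∀ y, V (d y) = v y := fun y =>
    congrFun (congrArg DFunLike.coe
      (IsQuotientMap.lift_comp (f := ⟨d, hd⟩) hq ⟨v, hv⟩ hfac)) y
  obtain ⟨q, hq⟩ := exists_polynomial_near_continuousMap (-1) 1 V ε hε
  refine ⟨q, fun y => ?_⟩
  rw [← hV y]
  exact ((q.toContinuousMapOn _ - V).norm_coe_le_norm (d y)).trans_lt hq

lemma integrable_mul_eval {p : ℕ} {v : Sph p → ℝ} (hv : Integrable v (surf p))
    (q : Polynomial ℝ) (x : Sph p) : Integrable (fun y => v y * q.eval (dotp x y)) (surf p) := by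
  obtain ⟨C, hC⟩ := (isCompact_range (continuous_eval_dotp q x)).isBounded.exists_norm_le
  exact hv.mul_bdd (c := C) (continuous_eval_dotp q x).aestronglyMeasurable
    (Eventually.of_forall fun y => hC _ ⟨y, rfl⟩)

/-- Orthogonality to all `P_k` passes to the zonal polynomials. -/
lemma integral_mul_eval_eq_zero {p : ℕ} (z : Sph p) {v : Sph p → ℝ}
    (hv : Integrable v (surf p)) {L : ℕ}
    (ho : ∀ k < L, ∫ y, v y * (legendrePoly p k).eval (dotp z y) ∂(surf p) = 0)
    {q : Polynomial ℝ} (hq : q ∈ Submodule.span ℝ (legendrePoly p '' Set.Iio L)) :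
    ∫ y, v y * q.eval (dotp z y) ∂(surf p) = 0 := by
  refine Submodule.span_induction (p := fun q _ => ∫ y, v y * q.eval (dotp z y) ∂(surf p) = 0)
    ?_ ?_ ?_ ?_ hq
  · rintro _ ⟨k, hk, rfl⟩
    exact ho k hk
  · simp
  · intro a b _ _ ha hb
    simp only [Polynomial.eval_add, mul_add]
    rw [integral_add (integrable_mul_eval hv a z) (integrable_mul_eval hv b z), ha, hb, add_zero]
  · intro c a _ ha
    simp only [Polynomial.eval_smul, smul_eq_mul, mul_left_comm _ c]
    rw [integral_const_mul, ha, mul_zero]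

/-- A continuous zonal function orthogonal to all Legendre polynomials vanishes. -/
lemma zonal_eq_zero_of_orthogonal {p : ℕ} (hp : 2 ≤ p) (z : Sph p) {v : Sph p → ℝ}
    (hv : Continuous v) (hz : ∀ x x', dotp x z = dotp x' z → v x = v x')
    (ho : ∀ k, ∫ y, v y * (legendrePoly p k).eval (dotp z y) ∂(surf p) = 0) : v = 0 := by
  have hvi := integrable_of_continuous_sph hv
  have hsq : ∫ y, v y * v y ∂(surf p) = 0 := by
    refine le_antisymm (le_of_forall_pos_le_add fun ε hε => ?_) (integral_nonneg fun y =>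
      mul_self_nonneg _)
    set I := ∫ y, |v y| ∂(surf p) with hI
    have hI0 : 0 ≤ I := integral_nonneg fun y => abs_nonneg _
    obtain ⟨q, hq⟩ := exists_polynomial_near_zonal hp z hv hz (ε := ε / (I + 1)) (by positivity)
    have h0 := integral_mul_eval_eq_zero z hvi (L := q.natDegree + 1) (fun k _ => ho k)
      (mem_span_legendrePoly hp q (Nat.lt_succ_self _))
    have h1 : Integrable (fun y => v y * v y) (surf p) := integrable_of_continuous_sph (hv.mul hv)
    have h2 : Integrable (fun y => v y * q.eval (dotp z y)) (surf p) :=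
      integrable_of_continuous_sph (hv.mul (continuous_eval_dotp q z))
    calc ∫ y, v y * v y ∂(surf p)
        = ∫ y, (v y * v y - v y * q.eval (dotp z y)) ∂(surf p) := by
          rw [integral_sub h1 h2, h0, sub_zero]
      _ ≤ ∫ y, ε / (I + 1) * |v y| ∂(surf p) := by
          refine integral_mono (h1.sub h2) (hvi.abs.const_mul _) fun y => ?_
          simp only
          calc v y * v y - v y * q.eval (dotp z y)
              ≤ |v y * v y - v y * q.eval (dotp z y)| := le_abs_self _
            _ = |q.eval (dotp z y) - v y| * |v y| := by
                rw [← mul_sub, abs_mul, abs_sub_comm, mul_comm]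
            _ ≤ ε / (I + 1) * |v y| :=
                mul_le_mul_of_nonneg_right (hq y).le (abs_nonneg _)
      _ = ε * (I / (I + 1)) := by rw [integral_const_mul, ← hI]; ring
      _ ≤ ε * 1 := by
          refine mul_le_mul_of_nonneg_left ?_ hε.le
          rw [div_le_one (by positivity)]; linarith
      _ = 0 + ε := by ring
  funext y
  by_contra hy
  have hy : v y ≠ 0 := hy
  have h := Continuous.integral_pos_of_hasCompactSupport_nonneg_nonzero (μ := surf p)
    (f := fun y => v y * v y) (x := y) (hv.mul hv) (HasCompactSupport.of_compactSpace _)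
    (fun y => mul_self_nonneg (v y)) (mul_self_ne_zero.2 hy)
  exact h.ne' hsq

lemma exists_abs_eval_le (q : Polynomial ℝ) : ∃ C, ∀ s ∈ Set.Icc (-1 : ℝ) 1, |q.eval s| ≤ C := by
  obtain ⟨C, hC⟩ := isCompact_Icc.exists_bound_of_continuousOn
    (q.continuous.continuousOn (s := Set.Icc (-1 : ℝ) 1))
  exact ⟨C, hC⟩

/-- The Funk–Hecke formula for zonal functions: the convolution of `P_ℓ` with a zonal function is a
multiple of `P_ℓ`, because it is a continuous zonal function orthogonal to all `P_k`, `k ≠ ℓ`. -/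
lemma funk_hecke {p : ℕ} (hp : 2 ≤ p) (ℓ : ℕ) {G : ℝ → ℝ} (z x : Sph p)
    (hG : Integrable (fun y => G (dotp z y)) (surf p)) :
    ∫ y, (legendrePoly p ℓ).eval (dotp x y) * G (dotp z y) ∂(surf p)
      = (∫ y, G (dotp z y) * (legendrePoly p ℓ).eval (dotp z y) ∂(surf p))
        * (legendrePoly p ℓ).eval (dotp z x) := by
  set Q := legendrePoly p ℓ with hQ
  set w : Sph p → ℝ := fun x => ∫ y, Q.eval (dotp x y) * G (dotp z y) ∂(surf p) with hw
  obtain ⟨C, hC⟩ := exists_abs_eval_le Q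
  have hwc : Continuous w := by
    refine continuous_of_dominated (bound := fun y => C * |G (dotp z y)|) (fun x => ?_)
      (fun x => Eventually.of_forall fun y => ?_) (hG.abs.const_mul C)
      (Eventually.of_forall fun y => ?_)
    · exact (continuous_eval_dotp Q x).aestronglyMeasurable.mul hG.aestronglyMeasurable
    · rw [norm_mul]
      exact mul_le_mul_of_nonneg_right (hC _ (dotp_mem x y)) (norm_nonneg _)
    · exact (Q.continuous.comp (continuous_dotp_left y)).mul continuous_const
  have hwz : ∀ x x', dotp x z = dotp x' z → w x = w x' := fun x x' h =>
    integral_dotp_dotp_congr (fun s => Q.eval s) G h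
  have hwi := integrable_of_continuous_sph hwc
  have horth : ∀ k, k ≠ ℓ → ∫ x, w x * (legendrePoly p k).eval (dotp z x) ∂(surf p) = 0 := by
    intro k hk
    have hprod : Integrable (Function.uncurry fun x y : Sph p =>
        Q.eval (dotp x y) * G (dotp z y) * (legendrePoly p k).eval (dotp z x))
        ((surf p).prod (surf p)) := by
      obtain ⟨C', hC'⟩ := exists_abs_eval_le (legendrePoly p k)
      have h1 : Integrable (fun q : Sph p × Sph p => G (dotp z q.2)) ((surf p).prod (surf p)) :=
        hG.comp_snd (surf p)
      have hC0 : 0 ≤ C := (abs_nonneg _).trans (hC 0 (by norm_num))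
      have h2 := h1.bdd_mul (c := C * C')
        (f := fun q : Sph p × Sph p =>
          Q.eval (dotp q.1 q.2) * (legendrePoly p k).eval (dotp z q.1))
        ((Q.continuous.comp continuous_dotp).mul
          ((continuous_eval_dotp _ z).comp continuous_fst)).aestronglyMeasurable
        (Eventually.of_forall fun q => by
          rw [norm_mul]
          exact mul_le_mul (hC _ (dotp_mem _ _)) (hC' _ (dotp_mem _ _)) (norm_nonneg _) hC0)
      refine h2.congr (Eventually.of_forall fun q => ?_)
      simp only [Function.uncurry]
      ring
    simp only [hw, ← integral_mul_const]
    rw [integral_integral_swap hprod]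
    refine (integral_congr_ae (g := 0) (Eventually.of_forall fun y => ?_)).trans
      (integral_zero' _ _)
    simp only [Pi.zero_apply]
    have h0 := integral_legendrePoly_mul_of_ne hp hk.symm y z
    calc ∫ x, Q.eval (dotp x y) * G (dotp z y) * (legendrePoly p k).eval (dotp z x) ∂(surf p)
        = ∫ x, G (dotp z y)
            * (Q.eval (dotp y x) * (legendrePoly p k).eval (dotp z x)) ∂(surf p) := by
          refine integral_congr_ae (Eventually.of_forall fun x => ?_)
          simp only [dotp_comm y x]; ring
      _ = 0 := by rw [integral_const_mul, h0, mul_zero]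
  -- `A` makes `w - A P_ℓ` orthogonal to `P_ℓ` as well; its value is read off at the pole.
  set A := normConst p ℓ * ∫ x, w x * Q.eval (dotp z x) ∂(surf p) with hA
  have hv : (fun x => w x - A * Q.eval (dotp z x)) = 0 := by
    refine zonal_eq_zero_of_orthogonal hp z (hwc.sub (continuous_const.mul
      (continuous_eval_dotp Q z))) (fun x x' h => ?_) fun k => ?_
    · rw [hwz x x' h, dotp_comm z x, dotp_comm z x', h]
    · have e : ∀ y, (w y - A * Q.eval (dotp z y)) * (legendrePoly p k).eval (dotp z y)
          = w y * (legendrePoly p k).eval (dotp z y)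
            - A * (Q.eval (dotp z y) * (legendrePoly p k).eval (dotp z y)) := fun y => by ring
      simp only [e]
      rw [integral_sub (integrable_mul_eval hwi _ z)
        ((integrable_eval_mul_eval _ _ z z).const_mul A), integral_const_mul]
      by_cases hk : k = ℓ
      · subst hk
        rw [hA, mul_right_comm, normConst_mul_integral_sq hp, one_mul, sub_self]
      · rw [horth k hk, integral_legendrePoly_mul_of_ne hp (Ne.symm hk), mul_zero, sub_zero]
  have hwA : ∀ x, w x = A * Q.eval (dotp z x) := fun x => sub_eq_zero.1 (congrFun hv x)
  have hz := hwA z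
  rw [dotp_self, eval_one_legendrePoly hp, mul_one] at hz
  change w x = _
  rw [hwA x, ← hz]
  congr 1
  refine integral_congr_ae (Eventually.of_forall fun y => ?_)
  simp only
  ring

/-- `|P_ℓ| ≤ 1` on `[-1,1]`, by the Funk–Hecke formula for `P_ℓ` and the Cauchy–Schwarz
inequality. -/
lemma abs_eval_legendrePoly_le {p : ℕ} (hp : 2 ≤ p) (ℓ : ℕ) (z x : Sph p) :
    |(legendrePoly p ℓ).eval (dotp z x)| ≤ 1 := by
  set Q := legendrePoly p ℓ with hQ
  have h := funk_hecke hp ℓ (G := fun s => Q.eval s) z x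
    (integrable_of_continuous_sph (continuous_eval_dotp Q z))
  have hpos := integral_legendrePoly_sq_pos hp ℓ z
  have hx := integral_dotp_eq (fun s => Q.eval s * Q.eval s) x z
  simp only [← hQ] at h hpos hx
  set I := ∫ y, Q.eval (dotp z y) * Q.eval (dotp z y) ∂(surf p) with hI
  have hle : |∫ y, Q.eval (dotp x y) * Q.eval (dotp z y) ∂(surf p)| ≤ I := by
    calc |∫ y, Q.eval (dotp x y) * Q.eval (dotp z y) ∂(surf p)|
        ≤ ∫ y, |Q.eval (dotp x y) * Q.eval (dotp z y)| ∂(surf p) := abs_integral_le_integral_abs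
      _ ≤ ∫ y, (1 / 2 * (Q.eval (dotp x y) * Q.eval (dotp x y))
            + 1 / 2 * (Q.eval (dotp z y) * Q.eval (dotp z y))) ∂(surf p) := by
          refine integral_mono (integrable_eval_mul_eval _ _ x z).abs
            (((integrable_eval_mul_eval _ _ x x).const_mul _).add
              ((integrable_eval_mul_eval _ _ z z).const_mul _)) fun y => ?_
          simp only
          rw [abs_le]
          constructor
          · nlinarith [sq_nonneg (Q.eval (dotp x y) + Q.eval (dotp z y))]
          · nlinarith [sq_nonneg (Q.eval (dotp x y) - Q.eval (dotp z y))]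
      _ = I := by
          rw [integral_add ((integrable_eval_mul_eval _ _ x x).const_mul _)
            ((integrable_eval_mul_eval _ _ z z).const_mul _), integral_const_mul,
            integral_const_mul, hx]
          ring
  rw [h, abs_mul, abs_of_pos hpos] at hle
  exact le_of_mul_le_mul_left (by rwa [mul_one]) hpos

/-! ### Legendre moments and iterated convolutions -/

lemma continuous_legendreP_dotp {p : ℕ} (hp : 2 ≤ p) (ℓ : ℕ) (z : Sph p) :
    Continuous fun y => legendreP p ℓ (dotp z y) := by
  simp only [legendreP_eq_eval hp]
  exact continuous_eval_dotp _ z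

lemma abs_legendreP_dotp_le {p : ℕ} (hp : 2 ≤ p) (ℓ : ℕ) (z y : Sph p) :
    |legendreP p ℓ (dotp z y)| ≤ 1 := by
  rw [legendreP_eq_eval hp]
  exact abs_eval_legendrePoly_le hp ℓ z y

lemma legendreP_one {p : ℕ} (hp : 2 ≤ p) (ℓ : ℕ) : legendreP p ℓ 1 = 1 := by
  rw [legendreP_eq_eval hp, eval_one_legendrePoly hp]

lemma integrable_mul_legendreP {p : ℕ} (hp : 2 ≤ p) {v : Sph p → ℝ} (hv : Integrable v (surf p))
    (ℓ : ℕ) (z : Sph p) : Integrable (fun y => v y * legendreP p ℓ (dotp z y)) (surf p) := by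
  simp only [legendreP_eq_eval hp]
  exact integrable_mul_eval hv _ z

namespace IsStepProfile

variable {p : ℕ} {g : ℝ → ℝ}

lemma nonneg_dotp (hg : IsStepProfile p g) (x y : Sph p) : 0 ≤ g (dotp x y) :=
  hg.nonneg _ (dotp_mem x y)

lemma measurable_dotp (hg : IsStepProfile p g) :
    Measurable fun q : Sph p × Sph p => g (dotp q.1 q.2) :=
  hg.measurable.comp continuous_dotp.measurable

lemma measurable_dotp_right (hg : IsStepProfile p g) (x : Sph p) :
    Measurable fun y => g (dotp x y) :=
  hg.measurable.comp (continuous_dotp_right x).measurable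

lemma integrable (hg : IsStepProfile p g) (x : Sph p) :
    Integrable (fun y => g (dotp x y)) (surf p) := by
  refine ⟨(hg.measurable_dotp_right x).aestronglyMeasurable, ?_⟩
  rw [hasFiniteIntegral_iff_ofReal (Eventually.of_forall fun y => hg.nonneg_dotp x y),
    hg.lintegral_eq_one]
  exact ENNReal.one_lt_top

lemma integral_eq_one (hg : IsStepProfile p g) (x : Sph p) :
    ∫ y, g (dotp x y) ∂(surf p) = 1 := by
  rw [integral_eq_lintegral_of_nonneg_ae (Eventually.of_forall fun y => hg.nonneg_dotp x y)
    (hg.measurable_dotp_right x).aestronglyMeasurable, hg.lintegral_eq_one, ENNReal.toReal_one]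

/-- The Funk–Hecke formula for the step density: the Legendre functions are eigenfunctions of the
transition operator of the walk, with the Fourier coefficients of the step as eigenvalues. -/
lemma integral_mul_legendreP (hg : IsStepProfile p g) (hp : 2 ≤ p) (ℓ : ℕ) (x z : Sph p) :
    ∫ y, g (dotp x y) * legendreP p ℓ (dotp z y) ∂(surf p)
      = fourierCoeff z (stepPdf g z) ℓ * legendreP p ℓ (dotp z x) := by
  simp only [fourierCoeff, stepPdf, legendreP_eq_eval hp]
  have h := funk_hecke hp ℓ (G := g) x z (hg.integrable x)
  rw [integral_dotp_eq (fun s => g s * (legendrePoly p ℓ).eval s) z x, dotp_comm z x, ← h]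
  exact integral_congr_ae (Eventually.of_forall fun y => mul_comm _ _)

lemma abs_fourierCoeff_le (hg : IsStepProfile p g) (hp : 2 ≤ p) (ℓ : ℕ) (z : Sph p) :
    |fourierCoeff z (stepPdf g z) ℓ| ≤ 1 := by
  calc |fourierCoeff z (stepPdf g z) ℓ|
      ≤ ∫ y, |g (dotp z y) * legendreP p ℓ (dotp z y)| ∂(surf p) := abs_integral_le_integral_abs
    _ ≤ ∫ y, g (dotp z y) ∂(surf p) := by
        refine integral_mono (integrable_mul_legendreP hp (hg.integrable z) ℓ z).abs
          (hg.integrable z) fun y => ?_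
        simp only
        rw [abs_mul, abs_of_nonneg (hg.nonneg_dotp z y)]
        exact mul_le_of_le_one_right (hg.nonneg_dotp z y) (abs_legendreP_dotp_le hp ℓ z y)
    _ = 1 := hg.integral_eq_one z

end IsStepProfile

/-- The iterated convolutions `f^{⊗(n+1)}` with values in `[0, ∞]`. They are densities without
any integrability proviso, and `convPdf` is their real part. -/
noncomputable def convLin {p : ℕ} (g : ℝ → ℝ) (z : Sph p) : ℕ → Sph p → ℝ≥0∞
  | 0, x => ENNReal.ofReal (g (dotp z x))
  | n + 1, x => ∫⁻ y, ENNReal.ofReal (g (dotp x y)) * convLin g z n y ∂(surf p)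

section Convolution

variable {p : ℕ} {g : ℝ → ℝ}

lemma measurable_convLin (hg : IsStepProfile p g) (z : Sph p) (n : ℕ) :
    Measurable (convLin g z n) := by
  induction n with
  | zero => exact (hg.measurable_dotp_right z).ennreal_ofReal
  | succ n ih =>
    exact Measurable.lintegral_prod_right' (ν := surf p)
      (f := fun q : Sph p × Sph p => ENNReal.ofReal (g (dotp q.1 q.2)) * convLin g z n q.2)
      (hg.measurable_dotp.ennreal_ofReal.mul (ih.comp measurable_snd))

/-- Tonelli's theorem for one step of the walk started from the density `convLin g z n`. -/
lemma setLIntegral_convLin_succ (hg : IsStepProfile p g) (z : Sph p) (n : ℕ) (B : Set (Sph p)) :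
    ∫⁻ x in B, convLin g z (n + 1) x ∂(surf p)
      = ∫⁻ y, convLin g z n y * ∫⁻ x in B, ENNReal.ofReal (g (dotp y x)) ∂(surf p) ∂(surf p) := by
  simp only [convLin]
  rw [lintegral_lintegral_swap]
  · refine lintegral_congr fun y => ?_
    rw [← lintegral_const_mul _ (hg.measurable_dotp_right y).ennreal_ofReal]
    exact lintegral_congr fun x => by rw [dotp_comm, mul_comm]
  · exact (hg.measurable_dotp.ennreal_ofReal.mul
      ((measurable_convLin hg z n).comp measurable_snd)).aemeasurable

lemma lintegral_convLin (hg : IsStepProfile p g) (z : Sph p) (n : ℕ) :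
    ∫⁻ x, convLin g z n x ∂(surf p) = 1 := by
  induction n with
  | zero => exact hg.lintegral_eq_one z
  | succ n ih =>
    have h := setLIntegral_convLin_succ hg z n Set.univ
    simpa only [Measure.restrict_univ, hg.lintegral_eq_one, mul_one, ih] using h

lemma ae_convLin_lt_top (hg : IsStepProfile p g) (z : Sph p) (n : ℕ) :
    ∀ᵐ x ∂(surf p), convLin g z n x < ∞ :=
  ae_lt_top (measurable_convLin hg z n) (by rw [lintegral_convLin hg]; exact ENNReal.one_ne_top)

/-- Where the convolution integral diverges both sides take the junk value `0`. -/
lemma convPdf_eq_toReal (hg : IsStepProfile p g) (z : Sph p) (n : ℕ) (x : Sph p) :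
    convPdf g z n x = (convLin g z n x).toReal := by
  induction n generalizing x with
  | zero => exact (ENNReal.toReal_ofReal (hg.nonneg_dotp z x)).symm
  | succ n ih =>
    simp only [convPdf, convLin]
    rw [← integral_toReal]
    · refine integral_congr_ae (Eventually.of_forall fun y => ?_)
      simp only
      rw [ENNReal.toReal_mul, ENNReal.toReal_ofReal (hg.nonneg_dotp x y), ih]
    · exact ((hg.measurable_dotp_right x).ennreal_ofReal.mul
        (measurable_convLin hg z n)).aemeasurable
    · filter_upwards [ae_convLin_lt_top hg z n] with y hy
      exact ENNReal.mul_lt_top ENNReal.ofReal_lt_top hy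

lemma convPdf_nonneg (hg : IsStepProfile p g) (z : Sph p) (n : ℕ) (x : Sph p) :
    0 ≤ convPdf g z n x := by
  rw [convPdf_eq_toReal hg]; exact ENNReal.toReal_nonneg

lemma measurable_convPdf (hg : IsStepProfile p g) (z : Sph p) (n : ℕ) :
    Measurable (convPdf g z n) := by
  rw [show convPdf g z n = fun x => (convLin g z n x).toReal from
    funext (convPdf_eq_toReal hg z n)]
  exact (measurable_convLin hg z n).ennreal_toReal

lemma integrable_convPdf (hg : IsStepProfile p g) (z : Sph p) (n : ℕ) :
    Integrable (convPdf g z n) (surf p) := by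
  rw [show convPdf g z n = fun x => (convLin g z n x).toReal from
    funext (convPdf_eq_toReal hg z n)]
  exact integrable_toReal_of_lintegral_ne_top (measurable_convLin hg z n).aemeasurable
    (by rw [lintegral_convLin hg]; exact ENNReal.one_ne_top)

lemma integral_convPdf (hg : IsStepProfile p g) (z : Sph p) (n : ℕ) :
    ∫ x, convPdf g z n x ∂(surf p) = 1 := by
  simp only [convPdf_eq_toReal hg]
  rw [integral_toReal (measurable_convLin hg z n).aemeasurable (ae_convLin_lt_top hg z n),
    lintegral_convLin hg, ENNReal.toReal_one]

/-- Convolution multiplies the Fourier coefficients. -/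
lemma fourierCoeff_convPdf (hg : IsStepProfile p g) (hp : 2 ≤ p) (z : Sph p) (n ℓ : ℕ) :
    fourierCoeff z (convPdf g z n) ℓ = fourierCoeff z (stepPdf g z) ℓ ^ (n + 1) := by
  induction n with
  | zero => rw [zero_add, pow_one]; rfl
  | succ n ih =>
    have hprod : Integrable (fun q : Sph p × Sph p => g (dotp q.1 q.2) * convPdf g z n q.2)
        ((surf p).prod (surf p)) := by
      have hm : AEStronglyMeasurable
          (fun q : Sph p × Sph p => g (dotp q.1 q.2) * convPdf g z n q.2)
          ((surf p).prod (surf p)) :=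
        (hg.measurable_dotp.mul
          ((measurable_convPdf hg z n).comp measurable_snd)).aestronglyMeasurable
      rw [integrable_prod_iff' hm]
      have e : ∀ y, ∫ x, ‖g (dotp x y) * convPdf g z n y‖ ∂(surf p) = convPdf g z n y := by
        intro y
        have : ∀ x, ‖g (dotp x y) * convPdf g z n y‖ = g (dotp y x) * convPdf g z n y := fun x => by
          rw [Real.norm_of_nonneg (mul_nonneg (hg.nonneg_dotp x y) (convPdf_nonneg hg z n y)),
            dotp_comm]
        simp only [this]
        rw [integral_mul_const, hg.integral_eq_one, one_mul]
      refine ⟨Eventually.of_forall fun y => ?_, ?_⟩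
      · simp only [dotp_comm _ y]
        exact (hg.integrable y).mul_const _
      · simp only [e]
        exact integrable_convPdf hg z n
    have hprod' : Integrable (Function.uncurry fun x y : Sph p =>
        g (dotp x y) * convPdf g z n y * legendreP p ℓ (dotp z x))
        ((surf p).prod (surf p)) := by
      have h2 := hprod.mul_bdd (c := 1) (g := fun q : Sph p × Sph p => legendreP p ℓ (dotp z q.1))
        ((continuous_legendreP_dotp hp ℓ z).comp continuous_fst).aestronglyMeasurable
        (Eventually.of_forall fun q => abs_legendreP_dotp_le hp ℓ z q.1)
      exact h2
    rw [fourierCoeff]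
    simp only [convPdf, ← integral_mul_const]
    rw [integral_integral_swap hprod', pow_succ, ← ih, fourierCoeff, ← integral_mul_const]
    refine integral_congr_ae (Eventually.of_forall fun y => ?_)
    simp only
    calc ∫ x, g (dotp x y) * convPdf g z n y * legendreP p ℓ (dotp z x) ∂(surf p)
        = ∫ x, convPdf g z n y * (g (dotp y x) * legendreP p ℓ (dotp z x)) ∂(surf p) := by
          refine integral_congr_ae (Eventually.of_forall fun x => ?_)
          simp only [dotp_comm y x]; ring
      _ = _ := by
          rw [integral_const_mul, hg.integral_mul_legendreP hp]; ring

lemma convPdf_succ_le_of_le (hg : IsStepProfile p g) (z : Sph p) {n : ℕ} {C : ℝ}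
    (hC : ∀ y, convPdf g z n y ≤ C) (x : Sph p) : convPdf g z (n + 1) x ≤ C := by
  have hb : Integrable (fun y => g (dotp x y) * convPdf g z n y) (surf p) :=
    (hg.integrable x).mul_bdd (c := C) (measurable_convPdf hg z n).aestronglyMeasurable
      (Eventually.of_forall fun y => by
        rw [Real.norm_of_nonneg (convPdf_nonneg hg z n y)]; exact hC y)
  calc convPdf g z (n + 1) x = ∫ y, g (dotp x y) * convPdf g z n y ∂(surf p) := rfl
    _ ≤ ∫ y, g (dotp x y) * C ∂(surf p) :=
        integral_mono hb ((hg.integrable x).mul_const C) fun y =>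
          mul_le_mul_of_nonneg_left (hC y) (hg.nonneg_dotp x y)
    _ = C := by rw [integral_mul_const, hg.integral_eq_one, one_mul]

lemma exists_bound_of_continuousOn (hc : ContinuousOn g (Set.Icc (-1) 1)) :
    ∃ C, ∀ x y : Sph p, ‖g (dotp x y)‖ ≤ C := by
  obtain ⟨C, hC⟩ := isCompact_Icc.exists_bound_of_continuousOn hc
  exact ⟨C, fun x y => hC _ (dotp_mem x y)⟩

lemma convPdf_le_of_bound (hg : IsStepProfile p g) (z : Sph p) {C : ℝ}
    (hC : ∀ x y : Sph p, ‖g (dotp x y)‖ ≤ C) (n : ℕ) (x : Sph p) : convPdf g z n x ≤ C := by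
  induction n generalizing x with
  | zero => exact (le_abs_self _).trans (hC z x)
  | succ n ih => exact convPdf_succ_le_of_le hg z ih x

lemma continuous_convPdf (hg : IsStepProfile p g) (hc : ContinuousOn g (Set.Icc (-1) 1))
    (z : Sph p) (n : ℕ) : Continuous (convPdf g z n) := by
  have hright : ∀ y : Sph p, Continuous fun x => g (dotp x y) := fun y =>
    hc.comp_continuous (continuous_dotp_left y) fun x => dotp_mem x y
  rcases n with _ | n
  · exact hc.comp_continuous (continuous_dotp_right z) fun x => dotp_mem z x
  · obtain ⟨C, hC⟩ := exists_bound_of_continuousOn (p := p) hc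
    refine continuous_of_dominated (bound := fun y => C * convPdf g z n y) (fun x => ?_)
      (fun x => Eventually.of_forall fun y => ?_) ((integrable_convPdf hg z n).const_mul C)
      (Eventually.of_forall fun y => (hright y).mul continuous_const)
    · exact ((hg.measurable_dotp_right x).mul (measurable_convPdf hg z n)).aestronglyMeasurable
    · rw [norm_mul, Real.norm_of_nonneg (convPdf_nonneg hg z n y)]
      exact mul_le_mul_of_nonneg_right (hC x y) (convPdf_nonneg hg z n y)

end Convolution

/-! ### Mean square convergence of zonal Fourier expansions -/

lemma eLpNorm_two_le_of_integral_sq_le {α : Type*} [MeasurableSpace α] {m : Measure α}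
    {u v : α → ℝ} (hu : MemLp u 2 m) (hv : MemLp v 2 m)
    (h : ∫ a, u a ^ 2 ∂m ≤ ∫ a, v a ^ 2 ∂m) : eLpNorm u 2 m ≤ eLpNorm v 2 m := by
  rw [hu.eLpNorm_eq_integral_rpow_norm two_ne_zero ENNReal.ofNat_ne_top,
    hv.eLpNorm_eq_integral_rpow_norm two_ne_zero ENNReal.ofNat_ne_top]
  simp only [ENNReal.toReal_ofNat, Real.rpow_two, Real.norm_eq_abs, sq_abs]
  exact ENNReal.ofReal_le_ofReal (Real.rpow_le_rpow (integral_nonneg fun a => sq_nonneg _) h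
    (by norm_num))

lemma memLp_of_continuous_sph {p : ℕ} {F : Sph p → ℝ} (hF : Continuous F) (q : ℝ≥0∞) :
    MemLp F q (surf p) :=
  hF.memLp_of_hasCompactSupport (HasCompactSupport.of_compactSpace F)

/-- Zonal polynomials are dense in the square integrable zonal functions. -/
lemma exists_polynomial_eLpNorm_sub_le {p : ℕ} {G : ℝ → ℝ} (hG : Measurable G) (z : Sph p)
    (h2 : MemLp (fun y => G (dotp z y)) 2 (surf p)) {ε : ℝ≥0∞} (hε : ε ≠ 0) :
    ∃ q : Polynomial ℝ, eLpNorm (fun y => G (dotp z y) - q.eval (dotp z y)) 2 (surf p) ≤ ε := by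
  have hd : Measurable (dotp z) := (continuous_dotp_right z).measurable
  have hGm : MemLp G 2 ((surf p).map (dotp z)) :=
    (memLp_map_measure_iff hG.aestronglyMeasurable hd.aemeasurable).2 h2
  obtain ⟨φ, hφ, hφm⟩ := hGm.exists_boundedContinuous_eLpNorm_sub_le ENNReal.ofNat_ne_top
    (ENNReal.half_pos hε).ne'
  rw [eLpNorm_map_measure (hG.sub φ.continuous.measurable).aestronglyMeasurable
    hd.aemeasurable] at hφ
  have ha : surf p Set.univ ^ (2 : ℝ≥0∞).toReal⁻¹ ≠ ∞ :=
    ENNReal.rpow_ne_top_of_nonneg (by norm_num) (measure_ne_top _ _)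
  obtain ⟨δ, hδ, hδε⟩ := ENNReal.exists_nnreal_pos_mul_lt ha (ENNReal.half_pos hε).ne'
  obtain ⟨q, hq⟩ := exists_polynomial_near_of_continuousOn (-1) 1 φ φ.continuous.continuousOn δ
    (by exact_mod_cast hδ)
  refine ⟨q, ?_⟩
  have hsplit : (fun y => G (dotp z y) - q.eval (dotp z y))
      = ((G - (φ : ℝ → ℝ)) ∘ dotp z) + fun y => φ (dotp z y) - q.eval (dotp z y) := by
    funext y; simp
  have hcont : Continuous fun y => φ (dotp z y) - q.eval (dotp z y) :=
    (φ.continuous.comp (continuous_dotp_right z)).sub (continuous_eval_dotp q z)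
  have hsmall : eLpNorm (fun y => φ (dotp z y) - q.eval (dotp z y)) 2 (surf p) ≤ ε / 2 := by
    refine (eLpNorm_le_of_ae_bound (C := δ) (Eventually.of_forall fun y => ?_)).trans ?_
    · rw [Real.norm_eq_abs, abs_sub_comm]
      exact (hq _ (dotp_mem z y)).le
    · rw [ENNReal.ofReal_coe_nnreal, mul_comm]
      exact hδε.le
  rw [hsplit]
  calc _ ≤ _ := eLpNorm_add_le
        ((hG.sub φ.continuous.measurable).comp hd).aestronglyMeasurable
        hcont.aestronglyMeasurable one_le_two
    _ ≤ ε / 2 + ε / 2 := add_le_add hφ hsmall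
    _ = ε := ENNReal.add_halves ε

/-- The partial sum of the Fourier expansion, as a polynomial in `cos ∠(z, y)`. -/
noncomputable def fourierPoly {p : ℕ} (z : Sph p) (f : Sph p → ℝ) (L : ℕ) : Polynomial ℝ :=
  ∑ ℓ ∈ Finset.range L, (normConst p ℓ * fourierCoeff z f ℓ) • legendrePoly p ℓ

lemma fourierSum_eq_eval {p : ℕ} (hp : 2 ≤ p) (z : Sph p) (f : Sph p → ℝ) (L : ℕ) (y : Sph p) :
    fourierSum z f L y = (fourierPoly z f L).eval (dotp z y) := by
  simp only [fourierSum, fourierPoly, Polynomial.eval_finsetSum, Polynomial.eval_smul, smul_eq_mul,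
    legendreP_eq_eval hp]

lemma continuous_fourierSum {p : ℕ} (hp : 2 ≤ p) (z : Sph p) (f : Sph p → ℝ) (L : ℕ) :
    Continuous (fourierSum z f L) := by
  rw [show fourierSum z f L = _ from funext (fourierSum_eq_eval hp z f L)]
  exact continuous_eval_dotp _ z

lemma fourierPoly_mem_span {p : ℕ} (z : Sph p) (f : Sph p → ℝ) (L : ℕ) :
    fourierPoly z f L ∈ Submodule.span ℝ (legendrePoly p '' Set.Iio L) :=
  sum_mem fun ℓ hℓ => Submodule.smul_mem _ _
    (Submodule.subset_span ⟨ℓ, Finset.mem_range.1 hℓ, rfl⟩)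

lemma integral_sub_fourierSum_mul {p : ℕ} (hp : 2 ≤ p) (z : Sph p) {f : Sph p → ℝ}
    (hf : Integrable f (surf p)) {L k : ℕ} (hk : k < L) :
    ∫ y, (f y - fourierSum z f L y) * (legendrePoly p k).eval (dotp z y) ∂(surf p) = 0 := by
  have e : ∀ y, (f y - fourierSum z f L y) * (legendrePoly p k).eval (dotp z y)
      = f y * (legendrePoly p k).eval (dotp z y)
        - ∑ ℓ ∈ Finset.range L, normConst p ℓ * fourierCoeff z f ℓ
          * ((legendrePoly p ℓ).eval (dotp z y) * (legendrePoly p k).eval (dotp z y)) := fun y => by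
    rw [sub_mul, fourierSum, Finset.sum_mul]
    simp only [legendreP_eq_eval hp, mul_assoc]
  simp only [e]
  rw [integral_sub (integrable_mul_eval hf _ z) (integrable_finsetSum _ fun ℓ _ =>
      (integrable_eval_mul_eval _ _ z z).const_mul _),
    integral_finsetSum _ fun ℓ _ => (integrable_eval_mul_eval _ _ z z).const_mul _]
  simp only [integral_const_mul]
  rw [Finset.sum_eq_single k]
  · rw [mul_right_comm, normConst_mul_integral_sq hp, one_mul, sub_eq_zero]
    simp only [fourierCoeff, legendreP_eq_eval hp]
  · intro ℓ _ hℓ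
    rw [integral_legendrePoly_mul_of_ne hp hℓ, mul_zero]
  · intro h
    exact absurd (Finset.mem_range.2 hk) h

/-- The partial sum of the Fourier expansion is the best mean square approximation. -/
lemma eLpNorm_sub_fourierSum_le {p : ℕ} (hp : 2 ≤ p) (z : Sph p) {f : Sph p → ℝ}
    (hf : MemLp f 2 (surf p)) (q : Polynomial ℝ) {L : ℕ} (hL : q.natDegree < L) :
    eLpNorm (fun y => f y - fourierSum z f L y) 2 (surf p)
      ≤ eLpNorm (fun y => f y - q.eval (dotp z y)) 2 (surf p) := by
  have hfi : Integrable f (surf p) := hf.integrable one_le_two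
  have hu : MemLp (fun y => f y - fourierSum z f L y) 2 (surf p) :=
    hf.sub (memLp_of_continuous_sph (continuous_fourierSum hp z f L) 2)
  have hv : MemLp (fun y => f y - q.eval (dotp z y)) 2 (surf p) :=
    hf.sub (memLp_of_continuous_sph (continuous_eval_dotp q z) 2)
  refine eLpNorm_two_le_of_integral_sq_le hu hv ?_
  set r := fourierPoly z f L - q with hr
  have hrs : r ∈ Submodule.span ℝ (legendrePoly p '' Set.Iio L) :=
    sub_mem (fourierPoly_mem_span z f L) (mem_span_legendrePoly hp q hL)
  have h0 := integral_mul_eval_eq_zero z (hu.integrable one_le_two)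
    (fun k hk => integral_sub_fourierSum_mul hp z hfi hk) hrs
  have e : ∀ y, (f y - q.eval (dotp z y)) ^ 2 = (f y - fourierSum z f L y) ^ 2
      + 2 * ((f y - fourierSum z f L y) * r.eval (dotp z y)) + r.eval (dotp z y) ^ 2 := fun y => by
    rw [hr, Polynomial.eval_sub, ← fourierSum_eq_eval hp]; ring
  have i1 := hu.integrable_sq
  have i2 := (integrable_mul_eval (hu.integrable one_le_two) r z).const_mul 2
  have i12 : Integrable (fun y => (f y - fourierSum z f L y) ^ 2
      + 2 * ((f y - fourierSum z f L y) * r.eval (dotp z y))) (surf p) := i1.add i2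
  have i3 : Integrable (fun y => r.eval (dotp z y) ^ 2) (surf p) :=
    integrable_of_continuous_sph ((continuous_eval_dotp r z).pow 2)
  simp only [e]
  rw [integral_add i12 i3, integral_add i1 i2, integral_const_mul, h0, mul_zero, add_zero]
  exact le_add_of_nonneg_right (integral_nonneg fun y => sq_nonneg _)

lemma tendsto_eLpNorm_fourierSum_sub {p : ℕ} (hp : 2 ≤ p) {G : ℝ → ℝ} (hG : Measurable G)
    (z : Sph p) (h2 : MemLp (stepPdf G z) 2 (surf p)) :
    Tendsto (fun L => eLpNorm (fun y => fourierSum z (stepPdf G z) L y - stepPdf G z y) 2 (surf p))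
      atTop (𝓝 0) := by
  rw [ENNReal.tendsto_nhds_zero]
  intro ε hε
  obtain ⟨q, hq⟩ := exists_polynomial_eLpNorm_sub_le hG z h2 hε.ne'
  filter_upwards [eventually_gt_atTop q.natDegree] with L hL
  refine le_trans (le_of_eq ?_) ((eLpNorm_sub_fourierSum_le hp z h2 q hL).trans hq)
  exact eLpNorm_sub_comm _ _ _ _

/-! ### Pointwise expansion of the iterated convolutions -/

section Expansion

variable {p : ℕ} {g : ℝ → ℝ}

lemma memLp_stepPdf_of_axis {z : Sph p} (h2 : MemLp (stepPdf g z) 2 (surf p)) (x : Sph p) :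
    MemLp (stepPdf g x) 2 (surf p) := by
  have h := h2.comp_measurePreserving (measurePreserving_sphMap (swapRefl x z))
  convert h using 1
  funext y
  simp only [stepPdf, Function.comp_apply]
  rw [← dotp_sphMap (swapRefl x z) x y, sphMap_swapRefl]

/-- The second convolution is an `L²` inner product of two step densities, so that it is
everywhere the sum of its expansion. -/
lemma tendsto_fourier_convPdf_one (hg : IsStepProfile p g) (hp : 2 ≤ p) (z : Sph p)
    (h2 : MemLp (stepPdf g z) 2 (surf p)) (x : Sph p) :
    Tendsto (fun L => ∑ ℓ ∈ Finset.range L, normConst p ℓ * fourierCoeff z (stepPdf g z) ℓ ^ 2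
      * legendreP p ℓ (dotp z x)) atTop (𝓝 (convPdf g z 1 x)) := by
  set f := stepPdf g z with hf
  have hx : MemLp (stepPdf g x) 2 (surf p) := memLp_stepPdf_of_axis h2 x
  have hS : ∀ L, MemLp (fourierSum z f L) 2 (surf p) := fun L =>
    memLp_of_continuous_sph (continuous_fourierSum hp z f L) 2
  have hcoef : ∀ L, ∫ y, (stepPdf g x * fourierSum z f L) y ∂(surf p)
      = ∑ ℓ ∈ Finset.range L, normConst p ℓ * fourierCoeff z f ℓ ^ 2
        * legendreP p ℓ (dotp z x) := by
    intro L
    have e : ∀ y, (stepPdf g x * fourierSum z f L) y = ∑ ℓ ∈ Finset.range L,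
        normConst p ℓ * fourierCoeff z f ℓ * (g (dotp x y) * legendreP p ℓ (dotp z y)) :=
      fun y => by
        simp only [Pi.mul_apply, stepPdf, fourierSum, Finset.mul_sum]
        exact Finset.sum_congr rfl fun ℓ _ => by ring
    simp only [e]
    rw [integral_finsetSum _ fun ℓ _ =>
      (integrable_mul_legendreP hp (hg.integrable x) ℓ z).const_mul _]
    refine Finset.sum_congr rfl fun ℓ _ => ?_
    rw [integral_const_mul, hg.integral_mul_legendreP hp]
    ring
  have hlim : Tendsto (fun L => eLpNorm (stepPdf g x * fourierSum z f L - stepPdf g x * f) 1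
      (surf p)) atTop (𝓝 0) := by
    have hupper := ENNReal.Tendsto.const_mul (a := eLpNorm (stepPdf g x) 2 (surf p))
      (tendsto_eLpNorm_fourierSum_sub hp hg.measurable z h2) (Or.inr hx.eLpNorm_ne_top)
    rw [mul_zero] at hupper
    refine tendsto_of_tendsto_of_tendsto_of_le_of_le tendsto_const_nhds hupper
      (fun L => bot_le) fun L => ?_
    have e : stepPdf g x * fourierSum z f L - stepPdf g x * f
        = stepPdf g x • fun y => fourierSum z f L y - f y := by
      funext y
      simp only [Pi.sub_apply, Pi.mul_apply, Pi.smul_apply', smul_eq_mul]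
      ring
    rw [e]
    exact eLpNorm_smul_le_mul_eLpNorm (p := 2) (q := 2) (r := 1)
      ((hS L).sub h2).aestronglyMeasurable hx.aestronglyMeasurable
  have h := tendsto_integral_of_L1' (stepPdf g x * f)
    (hx.aestronglyMeasurable.mul h2.aestronglyMeasurable)
    (Eventually.of_forall fun L => hx.integrable_mul (hS L)) hlim
  simp only [hcoef] at h
  exact h

lemma summable_normConst_mul_sq (hg : IsStepProfile p g) (hp : 2 ≤ p) (z : Sph p)
    (h2 : MemLp (stepPdf g z) 2 (surf p)) :
    Summable fun ℓ => normConst p ℓ * fourierCoeff z (stepPdf g z) ℓ ^ 2 := by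
  have h := tendsto_fourier_convPdf_one hg hp z h2 z
  simp only [dotp_self, legendreP_one hp, mul_one] at h
  exact ((hasSum_iff_tendsto_nat_of_nonneg
    (fun ℓ => mul_nonneg (normConst_pos hp ℓ).le (sq_nonneg _)) _).2 h).summable

lemma abs_expansion_term_le (hg : IsStepProfile p g) (hp : 2 ≤ p) (z : Sph p) (n ℓ : ℕ)
    (x : Sph p) :
    |normConst p ℓ * fourierCoeff z (stepPdf g z) ℓ ^ (n + 2) * legendreP p ℓ (dotp z x)|
      ≤ normConst p ℓ * fourierCoeff z (stepPdf g z) ℓ ^ 2 := by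
  have hc := (normConst_pos hp ℓ).le
  have hf := hg.abs_fourierCoeff_le hp ℓ z
  rw [abs_mul, abs_mul, abs_of_nonneg hc, abs_pow, pow_add, sq_abs]
  have h1 : |fourierCoeff z (stepPdf g z) ℓ| ^ n ≤ 1 := pow_le_one₀ (abs_nonneg _) hf
  have h2 := abs_legendreP_dotp_le hp ℓ z x
  have h3 : |fourierCoeff z (stepPdf g z) ℓ| ^ n * |legendreP p ℓ (dotp z x)| ≤ 1 :=
    mul_le_one₀ h1 (abs_nonneg _) h2
  calc _ = normConst p ℓ * fourierCoeff z (stepPdf g z) ℓ ^ 2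
        * (|fourierCoeff z (stepPdf g z) ℓ| ^ n * |legendreP p ℓ (dotp z x)|) := by ring
    _ ≤ _ := mul_le_of_le_one_right (mul_nonneg hc (sq_nonneg _)) h3

/-- For a square integrable step density, all convolutions of order at least two are everywhere the
absolutely convergent sums of their expansions. -/
lemma hasSum_convPdf_succ (hg : IsStepProfile p g) (hp : 2 ≤ p) (z : Sph p)
    (h2 : MemLp (stepPdf g z) 2 (surf p)) (n : ℕ) (x : Sph p) :
    HasSum (fun ℓ => normConst p ℓ * fourierCoeff z (stepPdf g z) ℓ ^ (n + 2)
      * legendreP p ℓ (dotp z x)) (convPdf g z (n + 1) x) := by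
  have hs := summable_normConst_mul_sq hg hp z h2
  have hsum : ∀ n x, Summable fun ℓ => normConst p ℓ * fourierCoeff z (stepPdf g z) ℓ ^ (n + 2)
      * legendreP p ℓ (dotp z x) := fun n x =>
    Summable.of_norm_bounded hs fun ℓ => abs_expansion_term_le hg hp z n ℓ x
  induction n generalizing x with
  | zero =>
    have h := (hsum 0 x).hasSum
    rwa [tendsto_nhds_unique h.tendsto_sum_nat (tendsto_fourier_convPdf_one hg hp z h2 x)] at h
  | succ n ih =>
    set F : ℕ → Sph p → ℝ := fun ℓ y => g (dotp x y)
      * (normConst p ℓ * fourierCoeff z (stepPdf g z) ℓ ^ (n + 2) * legendreP p ℓ (dotp z y))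
      with hF
    have hFi : ∀ ℓ, Integrable (F ℓ) (surf p) := fun ℓ => by
      refine ((integrable_mul_legendreP hp (hg.integrable x) ℓ z).const_mul
        (normConst p ℓ * fourierCoeff z (stepPdf g z) ℓ ^ (n + 2))).congr
        (Eventually.of_forall fun y => ?_)
      simp only [hF]; ring
    have hFn : Summable fun ℓ => ∫ y, ‖F ℓ y‖ ∂(surf p) := by
      refine Summable.of_nonneg_of_le (fun ℓ => integral_nonneg fun y => norm_nonneg _)
        (fun ℓ => ?_) hs
      calc ∫ y, ‖F ℓ y‖ ∂(surf p)
          ≤ ∫ y, g (dotp x y) * (normConst p ℓ * fourierCoeff z (stepPdf g z) ℓ ^ 2) ∂(surf p) := by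
            refine integral_mono (hFi ℓ).norm ((hg.integrable x).mul_const _) fun y => ?_
            simp only [hF, norm_mul (g (dotp x y)), Real.norm_of_nonneg (hg.nonneg_dotp x y)]
            exact mul_le_mul_of_nonneg_left (abs_expansion_term_le hg hp z n ℓ y)
              (hg.nonneg_dotp x y)
        _ = _ := by rw [integral_mul_const, hg.integral_eq_one, one_mul]
    have h := hasSum_integral_of_summable_integral_norm hFi hFn
    have e1 : ∀ ℓ, ∫ y, F ℓ y ∂(surf p) = normConst p ℓ
        * fourierCoeff z (stepPdf g z) ℓ ^ (n + 1 + 2) * legendreP p ℓ (dotp z x) := fun ℓ => by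
      have : ∀ y, F ℓ y = normConst p ℓ * fourierCoeff z (stepPdf g z) ℓ ^ (n + 2)
          * (g (dotp x y) * legendreP p ℓ (dotp z y)) := fun y => by simp only [hF]; ring
      simp only [this]
      rw [integral_const_mul, hg.integral_mul_legendreP hp]
      ring
    have e2 : ∫ y, ∑' ℓ, F ℓ y ∂(surf p) = convPdf g z (n + 1 + 1) x := by
      refine integral_congr_ae (Eventually.of_forall fun y => ?_)
      simp only [hF]
      rw [tsum_mul_left, (ih y).tsum_eq]
    simp only [e1] at h
    rwa [e2] at h

end Expansion

/-! ### Mixtures of the iterated convolutions -/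

/-- The mixture `∑ b_n f^{⊗(n+1)}` of the iterated convolutions. -/
noncomputable def convMix {p : ℕ} (g : ℝ → ℝ) (z : Sph p) (b : ℕ → ℝ) (x : Sph p) : ℝ :=
  ∑' n, b n * convPdf g z n x

lemma scatPdf_eq_convMix {p : ℕ} (ν : Measure ℝ) (g : ℝ → ℝ) (z : Sph p) :
    scatPdf ν g z = convMix g z fun n => poissonTransform ν (n + 1) := rfl

section Mixture

variable {p : ℕ} {g : ℝ → ℝ} {b : ℕ → ℝ}

lemma measurable_convMixLin (hg : IsStepProfile p g) (z : Sph p) (b : ℕ → ℝ) :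
    Measurable fun x => ∑' n, ENNReal.ofReal (b n) * convLin g z n x :=
  Measurable.tsum fun n => (measurable_convLin hg z n).const_mul _

lemma lintegral_convMixLin (hg : IsStepProfile p g) (z : Sph p) (hb : ∀ n, 0 ≤ b n)
    (hs : Summable b) :
    ∫⁻ x, ∑' n, ENNReal.ofReal (b n) * convLin g z n x ∂(surf p)
      = ENNReal.ofReal (∑' n, b n) := by
  rw [lintegral_tsum fun n => ((measurable_convLin hg z n).const_mul _).aemeasurable,
    ENNReal.ofReal_tsum_of_nonneg hb hs]
  refine tsum_congr fun n => ?_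
  rw [lintegral_const_mul _ (measurable_convLin hg z n), lintegral_convLin hg, mul_one]

lemma ae_convMixLin_lt_top (hg : IsStepProfile p g) (z : Sph p) (hb : ∀ n, 0 ≤ b n)
    (hs : Summable b) :
    ∀ᵐ x ∂(surf p), ∑' n, ENNReal.ofReal (b n) * convLin g z n x < ∞ :=
  ae_lt_top (measurable_convMixLin hg z b)
    (by rw [lintegral_convMixLin hg z hb hs]; exact ENNReal.ofReal_ne_top)

/-- The series defining the mixture converges almost everywhere, and its sum agrees there with the
`[0, ∞]`-valued mixture. -/
lemma convMix_ae_eq_toReal (hg : IsStepProfile p g) (z : Sph p) (hb : ∀ n, 0 ≤ b n)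
    (hs : Summable b) :
    convMix g z b =ᵐ[surf p] fun x => (∑' n, ENNReal.ofReal (b n) * convLin g z n x).toReal := by
  filter_upwards [ae_convMixLin_lt_top hg z hb hs] with x hx
  rw [ENNReal.tsum_toReal_eq fun n => ENNReal.ne_top_of_tsum_ne_top hx.ne n]
  refine tsum_congr fun n => ?_
  rw [ENNReal.toReal_mul, ENNReal.toReal_ofReal (hb n), convPdf_eq_toReal hg]

lemma ofReal_convMix_ae_eq (hg : IsStepProfile p g) (z : Sph p) (hb : ∀ n, 0 ≤ b n)
    (hs : Summable b) :
    (fun x => ENNReal.ofReal (convMix g z b x))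
      =ᵐ[surf p] fun x => ∑' n, ENNReal.ofReal (b n) * convLin g z n x := by
  filter_upwards [ae_convMixLin_lt_top hg z hb hs, convMix_ae_eq_toReal hg z hb hs] with x hx h
  rw [h, ENNReal.ofReal_toReal hx.ne]

lemma convMix_nonneg (hg : IsStepProfile p g) (z : Sph p) (hb : ∀ n, 0 ≤ b n) (x : Sph p) :
    0 ≤ convMix g z b x :=
  tsum_nonneg fun n => mul_nonneg (hb n) (convPdf_nonneg hg z n x)

lemma integrable_convMix (hg : IsStepProfile p g) (z : Sph p) (hb : ∀ n, 0 ≤ b n)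
    (hs : Summable b) : Integrable (convMix g z b) (surf p) :=
  (integrable_toReal_of_lintegral_ne_top (measurable_convMixLin hg z b).aemeasurable
    (by rw [lintegral_convMixLin hg z hb hs]; exact ENNReal.ofReal_ne_top)).congr
    (convMix_ae_eq_toReal hg z hb hs).symm

lemma continuous_convMix (hg : IsStepProfile p g) (hc : ContinuousOn g (Set.Icc (-1) 1))
    (z : Sph p) (hb : ∀ n, 0 ≤ b n) (hs : Summable b) : Continuous (convMix g z b) := by
  obtain ⟨C, hC⟩ := exists_bound_of_continuousOn (p := p) hc
  refine continuous_tsum (fun n => (continuous_convPdf hg hc z n).const_mul (b n))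
    (hs.mul_right C) fun n x => ?_
  rw [norm_mul, Real.norm_of_nonneg (hb n), Real.norm_of_nonneg (convPdf_nonneg hg z n x)]
  exact mul_le_mul_of_nonneg_left (convPdf_le_of_bound hg z hC n x) (hb n)

lemma hasSum_fourierCoeff_convMix (hg : IsStepProfile p g) (hp : 2 ≤ p) (z : Sph p)
    (hb : ∀ n, 0 ≤ b n) (hs : Summable b) (ℓ : ℕ) :
    HasSum (fun n => b n * fourierCoeff z (stepPdf g z) ℓ ^ (n + 1))
      (fourierCoeff z (convMix g z b) ℓ) := by
  set F : ℕ → Sph p → ℝ := fun n x => b n * convPdf g z n x * legendreP p ℓ (dotp z x) with hF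
  have hFi : ∀ n, Integrable (F n) (surf p) := fun n =>
    integrable_mul_legendreP hp ((integrable_convPdf hg z n).const_mul (b n)) ℓ z
  have hFn : Summable fun n => ∫ x, ‖F n x‖ ∂(surf p) := by
    refine Summable.of_nonneg_of_le (fun n => integral_nonneg fun x => norm_nonneg _)
      (fun n => ?_) hs
    calc ∫ x, ‖F n x‖ ∂(surf p) ≤ ∫ x, b n * convPdf g z n x ∂(surf p) := by
          refine integral_mono (hFi n).norm ((integrable_convPdf hg z n).const_mul _) fun x => ?_
          have h0 := mul_nonneg (hb n) (convPdf_nonneg hg z n x)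
          simp only [hF, norm_mul (b n * _), Real.norm_of_nonneg h0]
          exact mul_le_of_le_one_right h0 (abs_legendreP_dotp_le hp ℓ z x)
      _ = b n := by rw [integral_const_mul, integral_convPdf hg, mul_one]
  have h := hasSum_integral_of_summable_integral_norm hFi hFn
  have e : ∀ n, ∫ x, F n x ∂(surf p) = b n * fourierCoeff z (stepPdf g z) ℓ ^ (n + 1) := by
    intro n
    simp only [hF, mul_assoc]
    rw [integral_const_mul, ← fourierCoeff_convPdf hg hp, fourierCoeff]
  simp only [e] at h
  simp only [hF, tsum_mul_right] at h
  exact h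

/-- For a square integrable step density the series defining the mixture converges everywhere. -/
lemma summable_convMix (hg : IsStepProfile p g) (hp : 2 ≤ p) (z : Sph p)
    (h2 : MemLp (stepPdf g z) 2 (surf p)) (hb : ∀ n, 0 ≤ b n) (hs : Summable b) (x : Sph p) :
    Summable fun n => b n * convPdf g z n x := by
  rw [← summable_nat_add_iff 1]
  have hsq := summable_normConst_mul_sq hg hp z h2
  refine Summable.of_nonneg_of_le (fun n => mul_nonneg (hb _) (convPdf_nonneg hg z _ x))
    (fun n => mul_le_mul_of_nonneg_left ?_ (hb _))
    (((summable_nat_add_iff 1).2 hs).mul_right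
      (∑' ℓ, normConst p ℓ * fourierCoeff z (stepPdf g z) ℓ ^ 2))
  have h := hasSum_convPdf_succ hg hp z h2 n x
  rw [← h.tsum_eq]
  exact h.summable.tsum_le_tsum
    (fun ℓ => (le_abs_self _).trans (abs_expansion_term_le hg hp z n ℓ x)) hsq

/-- The part of the mixture of convolution order at least two is everywhere the absolutely
convergent sum of its expansion. -/
lemma hasSum_convMix_sub (hg : IsStepProfile p g) (hp : 2 ≤ p) (z : Sph p)
    (h2 : MemLp (stepPdf g z) 2 (surf p)) (hb : ∀ n, 0 ≤ b n) (hs : Summable b) (x : Sph p) :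
    HasSum (fun ℓ => normConst p ℓ * (fourierCoeff z (convMix g z b) ℓ
        - b 0 * fourierCoeff z (stepPdf g z) ℓ) * legendreP p ℓ (dotp z x))
      (convMix g z b x - b 0 * stepPdf g z x) := by
  set a : ℕ → ℝ := fun ℓ => fourierCoeff z (stepPdf g z) ℓ with ha
  have hsq := summable_normConst_mul_sq hg hp z h2
  have hs1 : Summable fun n => b (n + 1) := (summable_nat_add_iff 1).2 hs
  set F : ℕ × ℕ → ℝ := fun q =>
    b (q.1 + 1) * (normConst p q.2 * a q.2 ^ (q.1 + 2) * legendreP p q.2 (dotp z x)) with hF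
  have hFs : Summable F := by
    refine Summable.of_norm_bounded (hs1.mul_of_nonneg hsq (fun n => hb _)
      fun ℓ => mul_nonneg (normConst_pos hp ℓ).le (sq_nonneg _)) fun q => ?_
    rw [hF, norm_mul, Real.norm_of_nonneg (hb _)]
    exact mul_le_mul_of_nonneg_left (abs_expansion_term_le hg hp z q.1 q.2 x) (hb _)
  have hrow : HasSum (fun n => b (n + 1) * convPdf g z (n + 1) x) (∑' q, F q) :=
    hFs.hasSum.prod_fiberwise fun n => (hasSum_convPdf_succ hg hp z h2 n x).mul_left (b (n + 1))
  have hcol : HasSum (fun ℓ => normConst p ℓ * (fourierCoeff z (convMix g z b) ℓ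
        - b 0 * a ℓ) * legendreP p ℓ (dotp z x)) (∑' q, F q) := by
    have hsw : HasSum (F ∘ (Equiv.prodComm ℕ ℕ)) (∑' q, F q) :=
      (Equiv.prodComm ℕ ℕ).hasSum_iff.2 hFs.hasSum
    refine hsw.prod_fiberwise fun ℓ => ?_
    have h := (hasSum_nat_add_iff' 1).2 (hasSum_fourierCoeff_convMix hg hp z hb hs ℓ)
    simp only [Finset.sum_range_one, zero_add, pow_one] at h
    refine ((h.mul_left (normConst p ℓ)).mul_right (legendreP p ℓ (dotp z x))).congr_fun ?_
    intro n
    simp only [hF, ha, Function.comp_apply, Equiv.prodComm_apply, Prod.swap_prod_mk]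
    ring
  have htot : convMix g z b x - b 0 * stepPdf g z x = ∑' q, F q := by
    have h := (hasSum_nat_add_iff' 1).2 (summable_convMix hg hp z h2 hb hs x).hasSum
    rw [Finset.sum_range_one] at h
    exact h.unique hrow
  rw [htot]
  exact hcol

lemma abs_convMix_coeff_le (hg : IsStepProfile p g) (hp : 2 ≤ p) (z : Sph p)
    (hb : ∀ n, 0 ≤ b n) (hs : Summable b) (ℓ : ℕ) :
    |fourierCoeff z (convMix g z b) ℓ - b 0 * fourierCoeff z (stepPdf g z) ℓ|
      ≤ (∑' n, b n) * fourierCoeff z (stepPdf g z) ℓ ^ 2 := by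
  set a := fourierCoeff z (stepPdf g z) ℓ with ha
  have h := (hasSum_nat_add_iff' 1).2 (hasSum_fourierCoeff_convMix hg hp z hb hs ℓ)
  simp only [Finset.sum_range_one, zero_add, pow_one, ← ha] at h
  have hs1 : Summable fun n => b (n + 1) := (summable_nat_add_iff 1).2 hs
  have hle : ∀ n, ‖b (n + 1) * a ^ (n + 1 + 1)‖ ≤ b (n + 1) * a ^ 2 := fun n => by
    rw [norm_mul, Real.norm_of_nonneg (hb _), norm_pow, Real.norm_eq_abs, add_assoc, pow_add,
      sq_abs]
    refine mul_le_mul_of_nonneg_left (mul_le_of_le_one_left (sq_nonneg _) ?_) (hb _)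
    exact pow_le_one₀ (abs_nonneg _) (hg.abs_fourierCoeff_le hp ℓ z)
  rw [← h.tsum_eq]
  refine (tsum_of_norm_bounded (hs1.mul_right (a ^ 2)).hasSum hle).trans ?_
  rw [tsum_mul_right]
  refine mul_le_mul_of_nonneg_right ?_ (sq_nonneg _)
  rw [hs.tsum_eq_zero_add]
  exact le_add_of_nonneg_left (hb 0)

lemma fourierSum_convMix_sub (z : Sph p) (L : ℕ) (x : Sph p) :
    fourierSum z (convMix g z b) L x - b 0 * fourierSum z (stepPdf g z) L x
      = ∑ ℓ ∈ Finset.range L, normConst p ℓ * (fourierCoeff z (convMix g z b) ℓ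
        - b 0 * fourierCoeff z (stepPdf g z) ℓ) * legendreP p ℓ (dotp z x) := by
  rw [fourierSum, fourierSum, Finset.mul_sum, ← Finset.sum_sub_distrib]
  exact Finset.sum_congr rfl fun ℓ _ => by ring

lemma tendsto_fourierSum_convMix_sub (hg : IsStepProfile p g) (hp : 2 ≤ p) (z : Sph p)
    (h2 : MemLp (stepPdf g z) 2 (surf p)) (hb : ∀ n, 0 ≤ b n) (hs : Summable b) (x : Sph p) :
    Tendsto (fun L => fourierSum z (convMix g z b) L x - b 0 * fourierSum z (stepPdf g z) L x)
      atTop (𝓝 (convMix g z b x - b 0 * stepPdf g z x)) := by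
  simp only [fourierSum_convMix_sub]
  exact (hasSum_convMix_sub hg hp z h2 hb hs x).tendsto_sum_nat

lemma tendstoUniformly_fourierSum_convMix_sub (hg : IsStepProfile p g) (hp : 2 ≤ p) (z : Sph p)
    (h2 : MemLp (stepPdf g z) 2 (surf p)) (hb : ∀ n, 0 ≤ b n) (hs : Summable b) :
    TendstoUniformly
      (fun L x => fourierSum z (convMix g z b) L x - b 0 * fourierSum z (stepPdf g z) L x)
      (fun x => convMix g z b x - b 0 * stepPdf g z x) atTop := by
  have h := tendstoUniformly_tsum_nat (f := fun ℓ (x : Sph p) =>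
      normConst p ℓ * (fourierCoeff z (convMix g z b) ℓ
        - b 0 * fourierCoeff z (stepPdf g z) ℓ) * legendreP p ℓ (dotp z x))
    ((summable_normConst_mul_sq hg hp z h2).mul_left (∑' n, b n)) fun ℓ x => by
      have hc := (normConst_pos hp ℓ).le
      rw [norm_mul, norm_mul, Real.norm_of_nonneg hc, mul_left_comm]
      exact (mul_le_of_le_one_right (mul_nonneg hc (norm_nonneg _))
        (abs_legendreP_dotp_le hp ℓ z x)).trans
          (mul_le_mul_of_nonneg_left (abs_convMix_coeff_le hg hp z hb hs ℓ) hc)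
  simp only [fourierSum_convMix_sub]
  convert h using 2 with x
  exact (hasSum_convMix_sub hg hp z h2 hb hs x).tsum_eq.symm

end Mixture

lemma tendsto_eLpNorm_of_tendstoUniformly {α : Type*} [MeasurableSpace α] {m : Measure α}
    [IsFiniteMeasure m] {q : ℝ≥0∞} {F : ℕ → α → ℝ} {f : α → ℝ}
    (h : TendstoUniformly F f atTop) :
    Tendsto (fun L => eLpNorm (fun a => F L a - f a) q m) atTop (𝓝 0) := by
  rw [ENNReal.tendsto_nhds_zero]
  intro ε hε
  have ha : m Set.univ ^ q.toReal⁻¹ ≠ ∞ :=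
    ENNReal.rpow_ne_top_of_nonneg (by positivity) (measure_ne_top _ _)
  obtain ⟨δ, hδ, hδε⟩ := ENNReal.exists_nnreal_pos_mul_lt ha hε.ne'
  filter_upwards [Metric.tendstoUniformly_iff.1 h δ (by exact_mod_cast hδ)] with L hL
  refine (eLpNorm_le_of_ae_bound (C := δ) (Eventually.of_forall fun a => ?_)).trans ?_
  · rw [Real.norm_eq_abs, abs_sub_comm]
    exact (hL a).le
  · rw [ENNReal.ofReal_coe_nnreal, mul_comm]
    exact hδε.le

section MixtureL2

variable {p : ℕ} {g : ℝ → ℝ} {b : ℕ → ℝ}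

lemma memLp_convMix (hg : IsStepProfile p g) (hp : 2 ≤ p) (z : Sph p)
    (h2 : MemLp (stepPdf g z) 2 (surf p)) (hb : ∀ n, 0 ≤ b n) (hs : Summable b) :
    MemLp (convMix g z b) 2 (surf p) := by
  have hcont : Continuous fun x => convMix g z b x - b 0 * stepPdf g z x := by
    refine (tendstoUniformly_fourierSum_convMix_sub hg hp z h2 hb hs).continuous
      (Frequently.of_forall fun L => ?_)
    exact (continuous_fourierSum hp z _ L).sub
      (continuous_const.mul (continuous_fourierSum hp z _ L))
  have h := (memLp_of_continuous_sph hcont 2).add (h2.const_mul (b 0))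
  refine h.ae_eq (Eventually.of_forall fun x => ?_)
  simp only [Pi.add_apply]
  ring

lemma tendsto_eLpNorm_fourierSum_convMix (hg : IsStepProfile p g) (hp : 2 ≤ p) (z : Sph p)
    (h2 : MemLp (stepPdf g z) 2 (surf p)) (hb : ∀ n, 0 ≤ b n) (hs : Summable b) :
    Tendsto (fun L => eLpNorm (fun y => fourierSum z (convMix g z b) L y - convMix g z b y) 2
      (surf p)) atTop (𝓝 0) := by
  have hu := tendstoUniformly_fourierSum_convMix_sub hg hp z h2 hb hs
  have h1 := tendsto_eLpNorm_of_tendstoUniformly (m := surf p) (q := 2) hu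
  have h3 := ENNReal.Tendsto.const_mul (a := ‖b 0‖ₑ)
    (tendsto_eLpNorm_fourierSum_sub hp hg.measurable z h2) (Or.inr enorm_ne_top)
  have h4 := h1.add h3
  rw [mul_zero, add_zero] at h4
  refine tendsto_of_tendsto_of_tendsto_of_le_of_le tendsto_const_nhds h4 (fun L => bot_le)
    fun L => ?_
  have hS : ∀ v : Sph p → ℝ, MemLp (fourierSum z v L) 2 (surf p) := fun v =>
    memLp_of_continuous_sph (continuous_fourierSum hp z v L) 2
  have hm := memLp_convMix hg hp z h2 hb hs
  have e : (fun y => fourierSum z (convMix g z b) L y - convMix g z b y)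
      = (fun y => fourierSum z (convMix g z b) L y - b 0 * fourierSum z (stepPdf g z) L y
          - (convMix g z b y - b 0 * stepPdf g z y))
        + (b 0) • fun y => fourierSum z (stepPdf g z) L y - stepPdf g z y := by
    funext y
    simp only [Pi.add_apply, Pi.smul_apply, smul_eq_mul]
    ring
  rw [e]
  refine (eLpNorm_add_le ?_ ?_ one_le_two).trans (add_le_add le_rfl ?_)
  · exact (((hS _).sub ((hS _).const_mul _)).sub (hm.sub (h2.const_mul _))).aestronglyMeasurable
  · exact (((hS _).sub h2).const_smul (b 0)).aestronglyMeasurable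
  · exact eLpNorm_const_smul_le

/-- A continuous step density with absolutely summable Fourier coefficients is everywhere the sum of
its expansion. -/
lemma hasSum_stepPdf_of_summable (hg : IsStepProfile p g) (hp : 2 ≤ p) (z : Sph p)
    (hc : ContinuousOn g (Set.Icc (-1) 1)) (h2 : MemLp (stepPdf g z) 2 (surf p))
    (hs : Summable fun ℓ => normConst p ℓ * |fourierCoeff z (stepPdf g z) ℓ|) (x : Sph p) :
    HasSum (fun ℓ => normConst p ℓ * fourierCoeff z (stepPdf g z) ℓ * legendreP p ℓ (dotp z x))
      (stepPdf g z x) := by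
  set T : ℕ → Sph p → ℝ := fun ℓ x =>
    normConst p ℓ * fourierCoeff z (stepPdf g z) ℓ * legendreP p ℓ (dotp z x) with hT
  have hTle : ∀ ℓ x, ‖T ℓ x‖ ≤ normConst p ℓ * |fourierCoeff z (stepPdf g z) ℓ| := fun ℓ x => by
    have hc := (normConst_pos hp ℓ).le
    rw [hT, norm_mul, norm_mul, Real.norm_of_nonneg hc]
    exact mul_le_of_le_one_right (mul_nonneg hc (norm_nonneg _)) (abs_legendreP_dotp_le hp ℓ z x)
  have hu := tendstoUniformly_tsum_nat hs hTle
  have hTc : Continuous fun x => ∑' ℓ, T ℓ x :=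
    continuous_tsum (fun ℓ => (continuous_legendreP_dotp hp ℓ z).const_mul _) hs hTle
  have hfc : Continuous (stepPdf g z) :=
    hc.comp_continuous (continuous_dotp_right z) fun x => dotp_mem z x
  have h1 : Tendsto (fun L => eLpNorm (fun y => fourierSum z (stepPdf g z) L y - ∑' ℓ, T ℓ y) 2
      (surf p)) atTop (𝓝 0) := tendsto_eLpNorm_of_tendstoUniformly hu
  have h3 := (tendsto_eLpNorm_fourierSum_sub hp hg.measurable z h2).add h1
  rw [add_zero] at h3
  have h0 : eLpNorm (stepPdf g z - fun y => ∑' ℓ, T ℓ y) 2 (surf p) ≤ 0 := by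
    refine ge_of_tendsto' h3 fun L => ?_
    have hS : Continuous (fourierSum z (stepPdf g z) L) := continuous_fourierSum hp z _ L
    have e : (stepPdf g z - fun y => ∑' ℓ, T ℓ y)
        = (fun y => stepPdf g z y - fourierSum z (stepPdf g z) L y)
          + fun y => fourierSum z (stepPdf g z) L y - ∑' ℓ, T ℓ y := by
      funext y; simp
    rw [e]
    refine (eLpNorm_add_le (hfc.sub hS).aestronglyMeasurable (hS.sub hTc).aestronglyMeasurable
      one_le_two).trans (add_le_add (le_of_eq ?_) le_rfl)
    exact eLpNorm_sub_comm _ _ _ _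
  have hae : stepPdf g z =ᵐ[surf p] fun y => ∑' ℓ, T ℓ y := by
    have := (eLpNorm_eq_zero_iff (hfc.sub hTc).aestronglyMeasurable two_ne_zero).1
      (le_antisymm h0 bot_le)
    filter_upwards [this] with y hy
    exact sub_eq_zero.1 hy
  have heq := (hfc.ae_eq_iff_eq (surf p) hTc).1 hae
  rw [congrFun heq x]
  exact (Summable.of_norm_bounded hs fun ℓ => hTle ℓ x).hasSum

end MixtureL2

/-! ### Mixed Poisson laws -/

section MixedPoisson

variable {ν : Measure ℝ}

lemma poissonWeight_nonneg {u : ℝ} (hu : 0 ≤ u) (n : ℕ) :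
    0 ≤ Real.exp (-u) * u ^ n / (n.factorial : ℝ) := by positivity

lemma poissonWeight_le_one {u : ℝ} (hu : 0 ≤ u) (n : ℕ) :
    Real.exp (-u) * u ^ n / (n.factorial : ℝ) ≤ 1 := by
  rw [mul_div_assoc]
  calc _ ≤ Real.exp (-u) * Real.exp u :=
        mul_le_mul_of_nonneg_left (Real.pow_div_factorial_le_exp u hu n) (Real.exp_pos _).le
    _ = 1 := by rw [← Real.exp_add, neg_add_cancel, Real.exp_zero]

lemma hasSum_poissonWeight_mul_pow (u z : ℝ) :
    HasSum (fun n : ℕ => Real.exp (-u) * u ^ n / (n.factorial : ℝ) * z ^ n)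
      (Real.exp (-((1 - z) * u))) := by
  have h := (NormedSpace.expSeries_div_hasSum_exp (𝔸 := ℝ) (u * z)).mul_left (Real.exp (-u))
  rw [← Real.exp_eq_exp_ℝ, ← Real.exp_add] at h
  rw [show -((1 - z) * u) = -u + u * z by ring]
  exact h.congr_fun fun n => by rw [mul_pow]; ring

lemma integrable_poissonWeight [IsFiniteMeasure ν] (hν : ∀ᵐ u ∂ν, 0 ≤ u) (n : ℕ) :
    Integrable (fun u => Real.exp (-u) * u ^ n / (n.factorial : ℝ)) ν := by
  refine Integrable.of_bound (by fun_prop) 1 ?_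
  filter_upwards [hν] with u hu
  rw [Real.norm_of_nonneg (poissonWeight_nonneg hu n)]
  exact poissonWeight_le_one hu n

lemma poissonTransform_nonneg (hν : ∀ᵐ u ∂ν, 0 ≤ u) (n : ℕ) : 0 ≤ poissonTransform ν n :=
  integral_nonneg_of_ae (by filter_upwards [hν] with u hu using poissonWeight_nonneg hu n)

lemma summable_poissonTransform [IsProbabilityMeasure ν] (hν : ∀ᵐ u ∂ν, 0 ≤ u) :
    Summable (poissonTransform ν) := by
  refine summable_of_sum_range_le (c := 1) (poissonTransform_nonneg hν) fun m => ?_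
  simp only [poissonTransform]
  rw [← integral_finsetSum _ fun n _ => integrable_poissonWeight hν n]
  calc _ ≤ ∫ _, (1 : ℝ) ∂ν := by
        refine integral_mono_ae (integrable_finsetSum _ fun n _ => integrable_poissonWeight hν n)
          (integrable_const _) ?_
        filter_upwards [hν] with u hu
        have h := hasSum_poissonWeight_mul_pow u 1
        simp only [one_pow, mul_one, sub_self, zero_mul, neg_zero, Real.exp_zero] at h
        exact sum_le_hasSum _ (fun n _ => poissonWeight_nonneg hu n) h
    _ = 1 := by simp

/-- The generating function of the mixed Poisson law is a Laplace transform of the mixing law. -/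
lemma hasSum_poissonTransform_mul_pow [IsProbabilityMeasure ν] (hν : ∀ᵐ u ∂ν, 0 ≤ u) {z : ℝ}
    (hz : |z| ≤ 1) : HasSum (fun n => poissonTransform ν n * z ^ n) (laplace ν (1 - z)) := by
  have h := hasSum_integral_of_summable_integral_norm (μ := ν)
    (F := fun n u => Real.exp (-u) * u ^ n / (n.factorial : ℝ) * z ^ n)
    (fun n => (integrable_poissonWeight hν n).mul_const _) ?_
  · simp only [integral_mul_const, (hasSum_poissonWeight_mul_pow _ z).tsum_eq] at h
    exact h
  · refine Summable.of_nonneg_of_le (fun n => integral_nonneg fun u => norm_nonneg _) (fun n => ?_)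
      (summable_poissonTransform hν)
    refine integral_mono_ae ((integrable_poissonWeight hν n).mul_const _).norm
      (integrable_poissonWeight hν n) ?_
    filter_upwards [hν] with u hu
    have h0 := poissonWeight_nonneg hu n
    rw [norm_mul, Real.norm_of_nonneg h0, norm_pow]
    exact mul_le_of_le_one_right h0 (pow_le_one₀ (abs_nonneg _) hz)

lemma poissonTransform_zero : poissonTransform ν 0 = laplace ν 1 := by
  simp [poissonTransform, laplace]

lemma genFun_eq_laplace [IsProbabilityMeasure ν] (hν : ∀ᵐ u ∂ν, 0 ≤ u) {Ω : Type*}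
    [MeasurableSpace Ω] {P : Measure Ω} [IsProbabilityMeasure P] {N : Ω → ℕ} (hN : Measurable N)
    (hlaw : ∀ n, P.real {ω | N ω = n} = poissonTransform ν n) {z : ℝ} (hz : |z| ≤ 1) :
    genFun P N z = laplace ν (1 - z) := by
  have hint : Integrable (fun n : ℕ => z ^ n) (P.map N) := by
    have := Measure.isProbabilityMeasure_map (μ := P) hN.aemeasurable
    refine Integrable.of_bound (by fun_prop) 1 (Eventually.of_forall fun n => ?_)
    rw [norm_pow]
    exact pow_le_one₀ (abs_nonneg _) hz
  rw [genFun, ← integral_map (φ := N) (f := fun n : ℕ => z ^ n) hN.aemeasurable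
    hint.aestronglyMeasurable, integral_countable hint,
    ← (hasSum_poissonTransform_mul_pow hν hz).tsum_eq]
  refine tsum_congr fun n => ?_
  rw [map_measureReal_apply hN (measurableSet_singleton n), smul_eq_mul, ← hlaw n]
  rfl

lemma poissonTransform_dirac (u : ℝ) (n : ℕ) :
    poissonTransform (Measure.dirac u) n = Real.exp (-u) * u ^ n / (n.factorial : ℝ) := by
  rw [poissonTransform, integral_dirac]

lemma laplace_dirac (u z : ℝ) : laplace (Measure.dirac u) z = Real.exp (-(z * u)) := by
  rw [laplace, integral_dirac]

lemma integral_gammaMeasure {r θ : ℝ} (hr : 0 < r) (hθ : 0 < θ) (φ : ℝ → ℝ) :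
    ∫ u, φ u ∂(gammaMeasure r θ)
      = θ ^ r / Real.Gamma r * ∫ u in Set.Ioi 0, u ^ (r - 1) * Real.exp (-(θ * u)) * φ u := by
  rw [gammaMeasure, integral_withDensity_eq_integral_toReal_smul
    (f := gammaPDF r θ) (measurable_gammaPDFReal r θ).ennreal_ofReal
    (Eventually.of_forall fun u => ENNReal.ofReal_lt_top)]
  rw [← integral_const_mul, ← integral_Ici_eq_integral_Ioi, ← integral_indicator measurableSet_Ici]
  refine integral_congr_ae (Eventually.of_forall fun u => ?_)
  simp only
  rw [gammaPDF, ENNReal.toReal_ofReal (gammaPDFReal_nonneg hr hθ u), gammaPDFReal]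
  by_cases hu : 0 ≤ u
  · rw [if_pos hu, Set.indicator_of_mem (Set.mem_Ici.2 hu), smul_eq_mul]
    ring
  · rw [if_neg hu, Set.indicator_of_notMem (by simpa using hu), zero_smul]

lemma laplace_gammaMeasure {r θ z : ℝ} (hr : 0 < r) (hθ : 0 < θ) (hz : 0 ≤ z) :
    laplace (gammaMeasure r θ) z = (θ / (θ + z)) ^ r := by
  have hG := (Real.Gamma_pos_of_pos hr).ne'
  have hθz : 0 < θ + z := by linarith
  rw [laplace, integral_gammaMeasure hr hθ]
  have e : ∀ u : ℝ, u ^ (r - 1) * Real.exp (-(θ * u)) * Real.exp (-(z * u))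
      = u ^ (r - 1) * Real.exp (-((θ + z) * u)) := fun u => by
    rw [mul_assoc, ← Real.exp_add]; congr 2; ring
  simp only [e]
  rw [Real.integral_rpow_mul_exp_neg_mul_Ioi hr hθz, Real.div_rpow hθ.le hθz.le,
    Real.div_rpow zero_le_one hθz.le, Real.one_rpow]
  field_simp

/-- The Gamma mixture of Poisson laws is the negative binomial law. -/
lemma poissonTransform_gammaMeasure {r θ : ℝ} (hr : 0 < r) (hθ : 0 < θ) (n : ℕ) :
    poissonTransform (gammaMeasure r θ) n
      = Real.Gamma (n + r) / ((n.factorial : ℝ) * Real.Gamma r) * (1 - (θ + 1)⁻¹) ^ r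
        * (θ + 1)⁻¹ ^ n := by
  have hG := (Real.Gamma_pos_of_pos hr).ne'
  have hθ1 : 0 < θ + 1 := by linarith
  have hnr : 0 < (n : ℝ) + r := by positivity
  rw [poissonTransform, integral_gammaMeasure hr hθ]
  have e : ∫ u in Set.Ioi (0 : ℝ), u ^ (r - 1) * Real.exp (-(θ * u))
        * (Real.exp (-u) * u ^ n / (n.factorial : ℝ))
      = ∫ u in Set.Ioi (0 : ℝ), (n.factorial : ℝ)⁻¹
        * (u ^ ((n : ℝ) + r - 1) * Real.exp (-((θ + 1) * u))) := by
    refine setIntegral_congr_fun measurableSet_Ioi fun u hu => ?_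
    have hu : 0 < u := hu
    rw [show (n : ℝ) + r - 1 = (r - 1) + n by ring, Real.rpow_add hu, Real.rpow_natCast,
      show -((θ + 1) * u) = -(θ * u) + -u by ring, Real.exp_add]
    ring
  rw [e, integral_const_mul, Real.integral_rpow_mul_exp_neg_mul_Ioi hnr hθ1,
    show 1 - (θ + 1)⁻¹ = θ * (θ + 1)⁻¹ by field_simp; ring,
    Real.mul_rpow hθ.le (inv_nonneg.2 hθ1.le), one_div, Real.rpow_add (inv_pos.2 hθ1),
    Real.rpow_natCast]
  field_simp

end MixedPoisson

/-! ### The Cox process and the walk -/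

section CoxWalk

variable {p : ℕ} {Ω : Type*} [MeasurableSpace Ω] {P : Measure Ω} {g : ℝ → ℝ} {z : Sph p}
  {Λ : ℝ≥0 → Ω → ℝ} {N : ℝ≥0 → Ω → ℕ} {x : ℕ → Ω → Sph p}

lemma IsCoxProcess.intensity_nonneg (hC : IsCoxProcess P Λ N) (t : ℝ≥0) (ω : Ω) : 0 ≤ Λ t ω := by
  rw [← hC.intensity_zero ω]
  exact hC.intensity_mono ω zero_le

lemma IsCoxProcess.ae_nonneg_map (hC : IsCoxProcess P Λ N) (t : ℝ≥0) :
    ∀ᵐ u ∂(P.map (Λ t)), 0 ≤ u :=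
  (ae_map_iff (hC.measurable_intensity t).aemeasurable measurableSet_Ici).2
    (Eventually.of_forall (hC.intensity_nonneg t))

/-- The count at time `t` has the mixed Poisson law with mixing law the law of `Λ t`. -/
lemma IsCoxProcess.measureReal_count_eq (hC : IsCoxProcess P Λ N) (t : ℝ≥0) (n : ℕ) :
    P.real {ω | N t ω = n} = poissonTransform (P.map (Λ t)) n := by
  -- A single increment, over `(0, t]`.
  have h := hC.poisson_increments 1 (fun i => if i = 0 then 0 else t) (fun _ => n) Set.univ
    (monotone_nat_of_le_succ fun i => by
      by_cases hi : i = 0 <;> simp [hi]) MeasurableSet.univ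
  simp only [Nat.lt_one_iff, forall_eq, Set.univ_inter, Measure.restrict_univ, zero_add,
    one_ne_zero, if_false, if_true, hC.count_zero, hC.intensity_zero, sub_zero,
    Finset.prod_range_one] at h
  rw [Measure.real, h, poissonTransform,
    integral_map (hC.measurable_intensity t).aemeasurable (by fun_prop),
    integral_eq_lintegral_of_nonneg_ae
      (Eventually.of_forall fun ω => poissonWeight_nonneg (hC.intensity_nonneg t ω) n)]
  have := hC.measurable_intensity t
  exact (by fun_prop : Measurable _).aestronglyMeasurable

lemma IsIsotropicWalk.map_zero [IsProbabilityMeasure P] (hW : IsIsotropicWalk P g z x) :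
    P.map (x 0) = Measure.dirac z := by
  rw [show x 0 = fun _ => z from funext hW.start, Measure.map_const, measure_univ, one_smul]

/-- The law of the walk after `n + 1` steps has density `f^{⊗(n+1)}`. -/
lemma IsIsotropicWalk.map_succ [IsProbabilityMeasure P] (hg : IsStepProfile p g)
    (hW : IsIsotropicWalk P g z x) (n : ℕ) :
    P.map (x (n + 1)) = (surf p).withDensity (convLin g z n) := by
  have hm : ∀ B : Set (Sph p),
      Measurable fun y => ∫⁻ v in B, ENNReal.ofReal (g (dotp y v)) ∂(surf p) := fun B =>
    Measurable.lintegral_prod_right' (ν := (surf p).restrict B)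
      (f := fun q : Sph p × Sph p => ENNReal.ofReal (g (dotp q.1 q.2)))
      hg.measurable_dotp.ennreal_ofReal
  have hstep : ∀ k (B : Set (Sph p)), MeasurableSet B → P.map (x (k + 1)) B
      = ∫⁻ y, ∫⁻ v in B, ENNReal.ofReal (g (dotp y v)) ∂(surf p) ∂(P.map (x k)) := by
    intro k B hB
    have h := hW.step k Set.univ B MeasurableSet.univ hB
    rw [Set.univ_inter, Measure.restrict_univ] at h
    rw [Measure.map_apply (hW.measurable _) hB, h, lintegral_map (hm B) (hW.measurable k)]
  refine Measure.ext fun B hB => ?_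
  rw [hstep n B hB, withDensity_apply _ hB]
  induction n generalizing B with
  | zero => rw [hW.map_zero, lintegral_dirac' _ (hm B)]; rfl
  | succ n ih =>
    have hlaw : P.map (x (n + 1)) = (surf p).withDensity (convLin g z n) :=
      Measure.ext fun B' hB' => by rw [hstep n B' hB', withDensity_apply _ hB', ih B' hB']
    rw [hlaw, lintegral_withDensity_eq_lintegral_mul _ (measurable_convLin hg z n) (hm B),
      setLIntegral_convLin_succ hg z n B]
    rfl

lemma IsCompoundCox.measurable_position (hX : IsCompoundCox P g z Λ N x) (t : ℝ≥0) :
    Measurable (position N x t) := by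
  have h : Measurable fun q : ℕ × Ω => x q.1 q.2 :=
    measurable_from_prod_countable_right fun n => hX.walk.measurable n
  exact h.comp ((hX.cox.measurable_count t).prodMk measurable_id)

/-- The law of `x_t`, by conditioning on the number of steps. -/
lemma IsCompoundCox.map_position [IsProbabilityMeasure P] (hg : IsStepProfile p g)
    (hX : IsCompoundCox P g z Λ N x) (t : ℝ≥0) :
    P.map (position N x t) = P {ω | N t ω = 0} • Measure.dirac z
      + (surf p).withDensity fun y =>
        ∑' n, P {ω | N t ω = n + 1} * convLin g z n y := by
  have hN := hX.cox.measurable_count t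
  refine Measure.ext fun B hB => ?_
  rw [Measure.map_apply (hX.measurable_position t) hB]
  have hset : position N x t ⁻¹' B = ⋃ n, ({ω | N t ω = n} ∩ x n ⁻¹' B) := by
    ext ω
    simp [position]
  have hind : ∀ n, P ({ω | N t ω = n} ∩ x n ⁻¹' B) = P {ω | N t ω = n} * P.map (x n) B := by
    intro n
    have h := hX.indep.measure_inter_preimage_eq_mul ((fun w : ℕ → Sph p => w n) ⁻¹' B)
      ((fun v : ℝ≥0 → ℕ => v t) ⁻¹' {n}) (measurable_pi_apply n hB)
      (measurable_pi_apply t (measurableSet_singleton n))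
    rw [Measure.map_apply (hX.walk.measurable n) hB, mul_comm, Set.inter_comm]
    exact h
  rw [hset, measure_iUnion]
  · simp only [hind]
    rw [tsum_eq_zero_add' ENNReal.summable, hX.walk.map_zero, Measure.add_apply,
      Measure.smul_apply, smul_eq_mul, withDensity_apply _ hB,
      lintegral_tsum fun n => ((measurable_convLin hg z n).const_mul _).aemeasurable]
    congr 1
    refine tsum_congr fun n => ?_
    rw [lintegral_const_mul _ (measurable_convLin hg z n), hX.walk.map_succ hg,
      withDensity_apply _ hB]
  · intro m n hmn
    refine Set.disjoint_left.2 fun ω h1 h2 => hmn ?_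
    exact h1.1.symm.trans h2.1
  · intro n
    exact (hN (measurableSet_singleton n)).inter (hX.walk.measurable n hB)

end CoxWalk

end CoxSphere

/-! ### The compound Cox process -/

open CoxSphere in
theorem mainTheorem4 (p : ℕ) (hp : 2 ≤ p)
    {Ω : Type*} [MeasurableSpace Ω] (P : Measure Ω) [IsProbabilityMeasure P]
    (g : ℝ → ℝ) (hg : IsStepProfile p g) (μ : Sph p)
    (Λ : ℝ≥0 → Ω → ℝ) (N : ℝ≥0 → Ω → ℕ) (x : ℕ → Ω → Sph p)
    (hX : IsCompoundCox P g μ Λ N x) (t : ℝ≥0)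
    (ν : Measure ℝ) (hν : ν = P.map (Λ t))
    (f h : Sph p → ℝ) (hf : f = stepPdf g μ) (hh : h = scatPdf ν g μ) :
    -- the law of `N_t` and its mass at `0`
    (∀ n : ℕ, P.real {ω | N t ω = n} = poissonTransform ν n) ∧
    P.real {ω | N t ω = 0} = laplace ν 1 ∧
    P.real {ω | N t ω = 0} = genFun P (N t) 0 ∧
    -- the law of `x_t`: a mass at `μ` plus a part with density `h`
    Integrable h (surf p) ∧
    (ContinuousOn g (Set.Icc (-1) 1) → Continuous h) ∧
    P.map (position N x t)
      = P {ω | N t ω = 0} • Measure.dirac μ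
        + (surf p).withDensity (fun y => ENNReal.ofReal (h y)) ∧
    -- the Fourier coefficients of `h`
    (∀ ℓ : ℕ, Integrable (fun y => h y * legendreP p ℓ (dotp μ y)) (surf p) ∧
      fourierCoeff μ h ℓ = laplace ν (1 - fourierCoeff μ f ℓ) - laplace ν 1 ∧
      fourierCoeff μ h ℓ = genFun P (N t) (fourierCoeff μ f ℓ) - genFun P (N t) 0) ∧
    -- the Fourier expansion of `h`: in the space of square integrable functions, and pointwise
    (MemLp f 2 (surf p) →
      MemLp h 2 (surf p) ∧
      Tendsto (fun L => eLpNorm (fun y => fourierSum μ h L y - h y) 2 (surf p)) atTop (𝓝 0) ∧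
      (∀ y : Sph p,
        Tendsto (fun L => fourierSum μ h L y - poissonTransform ν 1 * fourierSum μ f L y) atTop
          (𝓝 (h y - poissonTransform ν 1 * f y))) ∧
      (∀ y : Sph p, Tendsto (fun L => fourierSum μ f L y) atTop (𝓝 (f y)) →
        Tendsto (fun L => fourierSum μ h L y) atTop (𝓝 (h y))) ∧
      (ContinuousOn g (Set.Icc (-1) 1) →
        Summable (fun ℓ => normConst p ℓ * |fourierCoeff μ f ℓ|) →
        ∀ y : Sph p, HasSum
          (fun ℓ => normConst p ℓ * fourierCoeff μ h ℓ * legendreP p ℓ (dotp μ y)) (h y))) ∧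
    -- the Legendre moments of `x_t`
    (∀ ℓ : ℕ, Integrable (fun ω => legendreP p ℓ (dotp μ (position N x t ω))) P ∧
      ∫ ω, legendreP p ℓ (dotp μ (position N x t ω)) ∂P
        = genFun P (N t) (fourierCoeff μ f ℓ) ∧
      ∫ ω, legendreP p ℓ (dotp μ (position N x t ω)) ∂P
        = laplace ν (1 - fourierCoeff μ f ℓ)) ∧
    -- the Poisson case
    (∀ u : ℝ, 0 ≤ u → (∀ᵐ ω ∂P, Λ t ω = u) →
      (∀ n : ℕ, P.real {ω | N t ω = n} = Real.exp (-u) * u ^ n / (n.factorial : ℝ)) ∧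
      ∀ ℓ : ℕ,
        fourierCoeff μ h ℓ = Real.exp (-u) * (Real.exp (u * fourierCoeff μ f ℓ) - 1) ∧
        ∫ ω, legendreP p ℓ (dotp μ (position N x t ω)) ∂P
          = Real.exp (-(u * (1 - fourierCoeff μ f ℓ)))) ∧
    -- the Gamma (negative binomial) case
    (∀ ξ θ r q : ℝ, 0 < ξ → 0 < θ → 0 < t → ν = gammaMeasure (ξ * t) θ →
      r = ξ * t → q = (θ + 1)⁻¹ →
      (∀ n : ℕ, P.real {ω | N t ω = n}
        = Real.Gamma (n + r) / ((n.factorial : ℝ) * Real.Gamma r) * (1 - q) ^ r * q ^ n) ∧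
      ∀ ℓ : ℕ,
        fourierCoeff μ h ℓ = (1 - q) ^ r * ((1 - q * fourierCoeff μ f ℓ) ^ (-r) - 1) ∧
        ∫ ω, legendreP p ℓ (dotp μ (position N x t ω)) ∂P
          = ((1 - q) / (1 - q * fourierCoeff μ f ℓ)) ^ r) := by
  subst hν hf hh
  have hC := hX.cox
  have hNm := hC.measurable_count t
  have hν0 := hC.ae_nonneg_map t
  have hΛm := hC.measurable_intensity t
  have hprob : IsProbabilityMeasure (P.map (Λ t)) :=
    Measure.isProbabilityMeasure_map hΛm.aemeasurable
  have hlaw := hC.measureReal_count_eq t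
  set ν := P.map (Λ t) with hν
  set f := stepPdf g μ with hf
  set b : ℕ → ℝ := fun n => poissonTransform ν (n + 1) with hb
  have hb0 : ∀ n, 0 ≤ b n := fun n => poissonTransform_nonneg hν0 _
  have hbs : Summable b := (summable_nat_add_iff 1).2 (summable_poissonTransform hν0)
  have hh : scatPdf ν g μ = convMix g μ b := scatPdf_eq_convMix ν g μ
  rw [hh]
  have ha : ∀ ℓ, |fourierCoeff μ f ℓ| ≤ 1 := fun ℓ => hg.abs_fourierCoeff_le hp ℓ μ
  have hgen : ∀ z : ℝ, |z| ≤ 1 → genFun P (N t) z = laplace ν (1 - z) := fun z hz =>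
    genFun_eq_laplace hν0 hNm hlaw hz
  have hgen0 : genFun P (N t) 0 = laplace ν 1 := by
    rw [hgen 0 (by simp), sub_zero]
  have hmass : P.real {ω | N t ω = 0} = laplace ν 1 := by rw [hlaw 0, poissonTransform_zero]
  have hint : Integrable (convMix g μ b) (surf p) := integrable_convMix hg μ hb0 hbs
  -- The law of `x_t`, first with the `[0, ∞]`-valued density.
  have hpos : P.map (position N x t) = P {ω | N t ω = 0} • Measure.dirac μ
      + (surf p).withDensity (fun y => ENNReal.ofReal (convMix g μ b y)) := by
    rw [hX.map_position hg t, withDensity_congr_ae (ofReal_convMix_ae_eq hg μ hb0 hbs)]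
    congr 2
    funext y
    refine tsum_congr fun n => ?_
    rw [hb]
    simp only
    rw [← hlaw (n + 1), ofReal_measureReal]
  have hcoeff : ∀ ℓ, fourierCoeff μ (convMix g μ b) ℓ
      = laplace ν (1 - fourierCoeff μ f ℓ) - laplace ν 1 := by
    intro ℓ
    have h1 := hasSum_fourierCoeff_convMix hg hp μ hb0 hbs ℓ
    have h2 := (hasSum_nat_add_iff' 1).2 (hasSum_poissonTransform_mul_pow hν0 (ha ℓ))
    rw [Finset.sum_range_one, pow_zero, mul_one, poissonTransform_zero] at h2
    exact h1.unique h2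
  have hmoment : ∀ ℓ, Integrable (fun ω => legendreP p ℓ (dotp μ (position N x t ω))) P ∧
      ∫ ω, legendreP p ℓ (dotp μ (position N x t ω)) ∂P
        = laplace ν (1 - fourierCoeff μ f ℓ) := by
    intro ℓ
    have hXm := hX.measurable_position t
    have hPc := continuous_legendreP_dotp hp ℓ μ
    constructor
    · exact Integrable.of_bound (hPc.measurable.comp hXm).aestronglyMeasurable 1
        (Eventually.of_forall fun ω => abs_legendreP_dotp_le hp ℓ μ _)
    have hdm : AEMeasurable (fun y => ENNReal.ofReal (convMix g μ b y)) (surf p) :=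
      hint.aemeasurable.ennreal_ofReal
    have hi : Integrable (fun y => legendreP p ℓ (dotp μ y)) (P.map (position N x t)) := by
      have := Measure.isProbabilityMeasure_map (μ := P) hXm.aemeasurable
      exact Integrable.of_bound hPc.aestronglyMeasurable 1
        (Eventually.of_forall fun y => abs_legendreP_dotp_le hp ℓ μ y)
    have hi' := hi
    rw [hpos] at hi'
    have h := integral_map (φ := position N x t) hXm.aemeasurable hi.aestronglyMeasurable
    rw [← h, hpos, integral_add_measure hi'.left_of_add_measure hi'.right_of_add_measure,
      integral_smul_measure, integral_dirac, dotp_self, legendreP_one hp, smul_eq_mul, mul_one,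
      integral_withDensity_eq_integral_toReal_smul₀ hdm
        (Eventually.of_forall fun y => ENNReal.ofReal_lt_top)]
    have e : ∫ y, (ENNReal.ofReal (convMix g μ b y)).toReal • legendreP p ℓ (dotp μ y) ∂(surf p)
        = fourierCoeff μ (convMix g μ b) ℓ := by
      refine integral_congr_ae (Eventually.of_forall fun y => ?_)
      simp only
      rw [ENNReal.toReal_ofReal (convMix_nonneg hg μ hb0 y), smul_eq_mul]
    rw [e, hcoeff ℓ, ← hmass, Measure.real]
    ring
  refine ⟨hlaw, hmass, by rw [hmass, hgen0], hint,
    fun hc => continuous_convMix hg hc μ hb0 hbs, hpos,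
    fun ℓ => ⟨integrable_mul_legendreP hp hint ℓ μ, hcoeff ℓ, ?_⟩, fun h2 => ⟨?_, ?_, ?_, ?_, ?_⟩,
    fun ℓ => ⟨(hmoment ℓ).1, ?_, (hmoment ℓ).2⟩, ?_, ?_⟩
  · rw [hcoeff ℓ, hgen _ (ha ℓ), hgen0]
  · exact memLp_convMix hg hp μ h2 hb0 hbs
  · exact tendsto_eLpNorm_fourierSum_convMix hg hp μ h2 hb0 hbs
  · exact tendsto_fourierSum_convMix_sub hg hp μ h2 hb0 hbs
  · intro y hy
    have h := (tendsto_fourierSum_convMix_sub hg hp μ h2 hb0 hbs y).add (hy.const_mul (b 0))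
    simpa only [← hf, sub_add_cancel] using h
  · intro hc hs y
    have h := (hasSum_convMix_sub hg hp μ h2 hb0 hbs y).add
      ((hasSum_stepPdf_of_summable hg hp μ hc h2 hs y).mul_left (b 0))
    rw [sub_add_cancel] at h
    exact h.congr_fun fun ℓ => by ring
  · rw [(hmoment ℓ).2, hgen _ (ha ℓ)]
  · intro u hu hΛ
    have hνu : ν = Measure.dirac u := by
      rw [hν, Measure.map_congr hΛ, Measure.map_const, measure_univ, one_smul]
    refine ⟨fun n => by rw [hlaw n, hνu, poissonTransform_dirac], fun ℓ => ⟨?_, ?_⟩⟩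
    · rw [hcoeff ℓ, hνu, laplace_dirac, laplace_dirac, one_mul]
      rw [mul_sub, ← Real.exp_add, mul_one]
      ring_nf
    · rw [(hmoment ℓ).2, hνu, laplace_dirac, mul_comm]
  · intro ξ θ r q hξ hθ ht hνG hr hq
    have hr0 : 0 < r := by rw [hr]; exact mul_pos hξ (by exact_mod_cast ht)
    rw [← hr] at hνG
    have hθ1 : 0 < θ + 1 := by linarith
    have hq1 : 1 - q = θ / (θ + 1) := by rw [hq]; field_simp; ring
    have hden : ∀ ℓ, 1 - q * fourierCoeff μ f ℓ
        = (θ + (1 - fourierCoeff μ f ℓ)) / (θ + 1) := fun ℓ => by rw [hq]; field_simp; ring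
    have h1a : ∀ ℓ, 0 ≤ 1 - fourierCoeff μ f ℓ := fun ℓ => sub_nonneg.2 (abs_le.1 (ha ℓ)).2
    have hlap : ∀ ℓ, laplace ν (1 - fourierCoeff μ f ℓ)
        = ((1 - q) / (1 - q * fourierCoeff μ f ℓ)) ^ r := fun ℓ => by
      rw [hνG, laplace_gammaMeasure hr0 hθ (h1a ℓ), hden, hq1, div_div_div_cancel_right₀ hθ1.ne']
    refine ⟨fun n => by rw [hlaw n, hνG, poissonTransform_gammaMeasure hr0 hθ, hq],
      fun ℓ => ⟨?_, by rw [(hmoment ℓ).2, hlap]⟩⟩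
    have hd : 0 ≤ 1 - q * fourierCoeff μ f ℓ := by
      rw [hden]; exact div_nonneg (add_nonneg hθ.le (h1a ℓ)) hθ1.le
    have hn : 0 ≤ 1 - q := by rw [hq1]; positivity
    rw [hcoeff ℓ, hlap, hνG, laplace_gammaMeasure hr0 hθ zero_le_one, ← hq1,
      Real.div_rpow hn hd, Real.rpow_neg hd]
    ring
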